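/- Let $c>0$ and $\theta<0$ be real numbers. The power series $$\operatorname{E}(z;c,\theta)=\sum_{n=1}^{\infty} e^{c n^{\theta}}(-z)^n ,\qquad |z|<1,$$ continues analytically to $\mathbb{C}\setminus(-\infty,-1]$; the continuation is also denoted $\operatorname{E}(z;c,\theta)$. Put $$K_1:=(2\pi(1-\theta))^{-1/2}(-c\theta)^{\frac{1}{2(\theta-1)}},\qquad K_2:=\Bigl(1-\frac1\theta\Bigr)(-c\theta)^{\frac{1}{1-\theta}},$$ which are positive, and, for an arbitrary real $\varepsilon>0$, $$\mu:=\begin{cases}\dfrac{\theta}{2(\theta-1)}-\varepsilon, & \theta\ge -2,\\[2mm] \dfrac{1}{1-\theta}, & \theta<-2.\end{cases}$$ Then $$\operatorname{E}(z;c,\theta)=-K_1(\log z)^{\frac{\theta}{2(1-\theta)}}\exp\Bigl(K_2(\log z)^{\frac{\theta}{\theta-1}}\Bigr)\Bigl(1+O\bigl((\log z)^{-\mu}\bigr)\Bigr)$$ as $z\to\infty$ in any sector $|\arg z|\le\pi-\delta$ with $\delta>0$. Here the logarithm and the powers are principal, and the implied constant may depend on $c,\theta,\delta,\varepsilon$.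 -/

import Mathlib

open Filter Asymptotics

noncomputable section

/-- The cut plane `ℂ ∖ (-∞, -1]`, written as the union of the plane slit along `(-∞, 0]`
and the open unit disc. -/
def cutPlane : Set ℂ := Complex.slitPlane ∪ Metric.ball 0 1

/-- `F` is (on the cut plane) the function `E(z; c, θ) = ∑_{n ≥ 1} exp (c n ^ θ) (-z) ^ n`:
it is the sum of this power series in the unit disc, and it continues that sum analytically
to the cut plane. -/
structure IsGeneralizedExp (c θ : ℝ) (F : ℂ → ℂ) : Prop where
  analytic : AnalyticOnNhd ℂ F cutPlane
  hasSum : ∀ z : ℂ, ‖z‖ < 1 →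
    HasSum (fun n : ℕ => (Real.exp (c * ((n + 1 : ℕ) : ℝ) ^ θ) : ℂ) * (-z) ^ (n + 1)) (F z)

/-- `K₁ = (2 π (1 - θ)) ^ (-1/2) (-c θ) ^ (1 / (2 (θ - 1)))`. -/
def saddleK1 (c θ : ℝ) : ℝ :=
  (2 * Real.pi * (1 - θ)) ^ (-(1 / 2) : ℝ) * (-(c * θ)) ^ (1 / (2 * (θ - 1)) : ℝ)

/-- `K₂ = (1 - 1 / θ) (-c θ) ^ (1 / (1 - θ))`. -/
def saddleK2 (c θ : ℝ) : ℝ :=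
  (1 - 1 / θ) * (-(c * θ)) ^ (1 / (1 - θ) : ℝ)

/-- The exponent of the relative error. -/
def saddleMu (θ ε : ℝ) : ℝ :=
  if -2 ≤ θ then θ / (2 * (θ - 1)) - ε else 1 / (1 - θ)

/-- The main term `-K₁ (log z) ^ (θ / (2 (1 - θ))) exp (K₂ (log z) ^ (θ / (θ - 1)))`,
with the principal logarithm and principal powers. -/
def saddleMain (c θ : ℝ) (z : ℂ) : ℂ :=
  -(saddleK1 c θ : ℂ) * Complex.log z ^ ((θ / (2 * (1 - θ)) : ℝ) : ℂ) *
    Complex.exp ((saddleK2 c θ : ℂ) * Complex.log z ^ ((θ / (θ - 1) : ℝ) : ℂ))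

/-- The filter `z → ∞` within the sector `|arg z| ≤ π - δ`. -/
def inftyInSector (δ : ℝ) : Filter ℂ :=
  Bornology.cobounded ℂ ⊓ 𝓟 {z : ℂ | |z.arg| ≤ Real.pi - δ}

end

/-! Write `θ = -a`, `β = a / (1 + a)`, `W t = wright a (c * t ^ a)`. Termwise, the Laplace transform
of `W` at `m` is `exp (c * m ^ (-a)) / m`. Multiplying by `m (-z) ^ m` and summing the
geometric-type series under the integral gives `E z = -∫ W t * k_z t` over `t > 0`, with `k_z t = z
e^{-t} / (1 + z e^{-t})²`. This integral is analytic on the whole cut plane, hence is the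
continuation.

The kernel `k_z` is the derivative of `(1 + z e^{-t})⁻¹`, so its total mass is `1 - (1 + z)⁻¹`; in a
sector it is `O(exp (-|t - log ‖z‖|))`. Thus `E z` is close to `-W` "evaluated at `log z`", and the
main term is the asymptotic form `K₁ t ^ (-β/2) exp (K₂ t ^ β)` of `W` continued to `t = log z`. The
logarithmic derivative of this form is `O(t ^ (β - 1))`, so replacing `t` by `log z` costs a
relative error of that order, up to an exponential in `|t - log ‖z‖|` which the kernel absorbs
(`exists_norm_div_sub_one_le`).

The asymptotics of `W` (`exists_abs_wright_sub_le`) need no saddle point argument. By Stirling, `k!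
Γ(a k + 1)` is a geometric factor times `Γ((1 + a) k + 3/2)` up to a constant and a relative error
`O(1/k)`. This leaves a sum of `Y ^ s / Γ(s + 1)` over an arithmetic progression. Comparing Riemann
sums of this unimodal function with steps `1 + a` and `1` reduces it to the exponential series, with
relative error `O(Y ^ (-1/2))`, that is `O(t ^ (-β/2))`. The final error exponent is the smaller of
`β / 2` and `1 - β`. -/

/-! ### Stirling's formula for `Γ` with error `O(1/s)`. -/

open Real in
/-- Log-convexity of `Γ` interpolated between consecutive integers. -/
theorem abs_log_Gamma_nat_add_sub_le {n : ℕ} (hn : n ≠ 0) {τ : ℝ} (h0 : 0 ≤ τ) (h1 : τ ≤ 1) :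
    |log (Gamma (n + τ)) - (log (Gamma n) + τ * log n)| ≤ 1 / n := by
  have hn0 : (0 : ℝ) < n := by positivity
  have hconv := convexOn_log_Gamma
  have hG : log (Gamma (n + 1)) = log n + log (Gamma n) := by
    rw [Gamma_add_one hn0.ne', log_mul hn0.ne' (Gamma_pos_of_pos hn0).ne']
  have hup : log (Gamma (n + τ)) ≤ log (Gamma n) + τ * log n := by
    have := hconv.2 (Set.mem_Ioi.2 hn0) (Set.mem_Ioi.2 (by positivity : 0 < (n : ℝ) + 1))
      (by linarith : 0 ≤ 1 - τ) h0 (by ring)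
    simp only [smul_eq_mul, Function.comp] at this
    rw [hG, show (1 - τ) * (n : ℝ) + τ * (n + 1) = n + τ by ring] at this
    linarith
  -- Here `n + 1` is the convex combination of `n + τ` and `n + τ + 1` with weights `τ` and `1 - τ`.
  have hlo : log (Gamma (n + 1)) ≤ log (Gamma (n + τ)) + (1 - τ) * log (n + τ) := by
    have hs : 0 < n + τ := by positivity
    have := hconv.2 (Set.mem_Ioi.2 hs) (Set.mem_Ioi.2 (by positivity : 0 < n + τ + 1))
      h0 (by linarith : 0 ≤ 1 - τ) (by ring)
    simp only [smul_eq_mul, Function.comp] at this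
    rw [Gamma_add_one hs.ne', log_mul hs.ne' (Gamma_pos_of_pos hs).ne',
      show τ * (n + τ) + (1 - τ) * (n + τ + 1) = n + 1 by ring] at this
    linarith
  have hlog : log (n + τ) ≤ log n + τ / n := by
    have : log (n + τ) - log n = log ((n + τ) / n) := (log_div (by positivity) hn0.ne').symm
    have h2 := log_le_sub_one_of_pos (x := (n + τ) / n) (by positivity)
    have h3 : (n + τ) / n - 1 = τ / n := by field_simp; ring
    linarith
  have h4 : (1 - τ) * log (n + τ) ≤ (1 - τ) * log n + τ / n := by
    have hd : 0 ≤ τ / n := by positivity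
    nlinarith [mul_le_mul_of_nonneg_left hlog (by linarith : 0 ≤ 1 - τ)]
  have h5 : τ / n ≤ 1 / n := by gcongr
  rw [abs_le]
  constructor
  · linarith
  · have : 0 ≤ 1 / (n : ℝ) := by positivity
    linarith

-- The decrements of `log (stirlingSeq k)` are at most `1 / (12 k (k + 1))`, which telescopes;
-- letting `k → ∞` gives the upper bound.
open Real Filter Topology in
theorem abs_log_factorial_sub_stirling_le {n : ℕ} (hn : n ≠ 0) :
    |log (n.factorial) - ((n + 1 / 2) * log n - n + log (2 * π) / 2)| ≤ 1 / n := by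
  have hn0 : (0 : ℝ) < n := by positivity
  have hstep (k : ℕ) (hk : n ≤ k) : log (Stirling.stirlingSeq n) ≤
      log (Stirling.stirlingSeq k) + 1 / 12 * (1 / n - 1 / k) := by
    induction k, hk using Nat.le_induction with
    | base => simp
    | succ k hk ih =>
      have hk0 : (0 : ℝ) < k := by
        have : 0 < k := by omega
        positivity
      have := Stirling.log_stirlingSeq_sdiff_le k
      have e : (1 : ℝ) / (12 * k * (k + 1)) = 1 / 12 * (1 / k - 1 / (k + 1)) := by
        field_simp; ring
      push_cast
      linarith
  have hlim : Tendsto (fun k : ℕ => log (Stirling.stirlingSeq k) + 1 / 12 * (1 / n - 1 / (k : ℝ)))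
      atTop (𝓝 (log (√π) + 1 / 12 * (1 / n - 0))) := by
    refine ((Stirling.tendsto_stirlingSeq_sqrt_pi).log (by positivity)).add ?_
    exact (tendsto_const_nhds.sub tendsto_one_div_atTop_nhds_zero_nat).const_mul _
  have h1 : log (Stirling.stirlingSeq n) ≤ log (√π) + 1 / 12 * (1 / n - 0) :=
    ge_of_tendsto hlim (eventually_atTop.2 ⟨n, hstep⟩)
  have h2 := Stirling.le_log_factorial_stirling hn
  rw [Stirling.log_stirlingSeq_formula, log_sqrt pi_pos.le, log_div hn0.ne' (exp_pos _).ne',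
    log_exp, log_mul two_ne_zero hn0.ne'] at h1
  rw [log_mul two_ne_zero pi_ne_zero] at h2 ⊢
  have h3 : 0 < 1 / (n : ℝ) := by positivity
  rw [abs_le]
  constructor <;> nlinarith

open Real in
/-- The expansion of `(s + b - 1/2) log (s + b)`, with an error term `O(1/s)`. -/
theorem abs_mul_log_add_sub_le {s b : ℝ} (hs : 0 < s) (hb : 0 ≤ b) (hb' : 1 / 2 ≤ s + b) :
    |(s + b - 1 / 2) * log (s + b) - ((s + b - 1 / 2) * log s + b)| ≤ (b ^ 2 + b) / s := by
  have e : log (s + b) - log s = log ((s + b) / s) := (log_div (by positivity) hs.ne').symm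
  have h1 := log_le_sub_one_of_pos (x := (s + b) / s) (by positivity)
  have h2 := one_sub_inv_le_log_of_pos (x := (s + b) / s) (by positivity)
  rw [← e] at h1 h2
  have e1 : (s + b) / s - 1 = b / s := by field_simp; ring
  have e2 : 1 - ((s + b) / s)⁻¹ = b / (s + b) := by
    have : s + b ≠ 0 := by positivity
    field_simp; ring
  rw [e1] at h1
  rw [e2] at h2
  have hc : 0 ≤ s + b - 1 / 2 := by linarith
  have h3 := mul_le_mul_of_nonneg_left h1 hc
  have h4 := mul_le_mul_of_nonneg_left h2 hc
  have e3 : (s + b - 1 / 2) * (b / s) = b + (b ^ 2 - b / 2) / s := by field_simp; ring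
  have e4 : (s + b - 1 / 2) * (b / (s + b)) = b - (b / 2) / (s + b) := by
    have : s + b ≠ 0 := by positivity
    field_simp
  have h5 : (b ^ 2 - b / 2) / s ≤ (b ^ 2 + b) / s := by gcongr; linarith
  have h6 : (b / 2) / (s + b) ≤ (b ^ 2 + b) / s := by gcongr <;> nlinarith
  rw [abs_le]
  constructor <;> linarith

open Real in
theorem abs_log_Gamma_sub_stirling_le {s : ℝ} (hs : 1 ≤ s) :
    |log (Gamma s) - ((s - 1 / 2) * log s - s + log (2 * π) / 2)| ≤ 8 / s := by
  set n := ⌊s⌋₊ with hn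
  have hn0 : n ≠ 0 := (Nat.floor_pos.2 hs).ne'
  have hnr : (1 : ℝ) ≤ n := by exact_mod_cast Nat.one_le_iff_ne_zero.2 hn0
  obtain ⟨τ, hτ⟩ : ∃ τ : ℝ, s = n + τ := ⟨s - n, by ring⟩
  have h0 : 0 ≤ τ := by linarith [Nat.floor_le (by linarith : 0 ≤ s)]
  have h1 : τ ≤ 1 := by linarith [Nat.lt_floor_add_one s]
  have hA := abs_log_Gamma_nat_add_sub_le hn0 h0 h1
  have hB := abs_log_factorial_sub_stirling_le hn0
  have hC := abs_mul_log_add_sub_le (s := n) (b := τ) (by linarith) h0 (by linarith)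
  have hD : log n.factorial = log n + log (Gamma n) := by
    rw [← Gamma_nat_eq_factorial, Gamma_add_one (by positivity),
      log_mul (by positivity) (Gamma_pos_of_pos (by positivity)).ne']
  have hE : (τ ^ 2 + τ) / n ≤ 2 / n := by gcongr; nlinarith
  -- The three errors are at most `1/n`, `1/n` and `2/n`, and `s ≤ n + 1 ≤ 2 n`.
  have hF : 4 / (n : ℝ) ≤ 8 / s := by
    rw [div_le_div_iff₀ (by linarith) (by linarith)]; linarith
  have e1 : 2 / (n : ℝ) = 2 * (1 / n) := by ring
  have e2 : 4 / (n : ℝ) = 4 * (1 / n) := by ring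
  rw [hD] at hB
  rw [← hτ] at hA hC
  rw [abs_le] at *
  have hs' : s * log s = (n + τ) * log s := by rw [← hτ]
  constructor <;> nlinarith

open Real in
/-- **Stirling's formula** for the Gamma function with a shifted argument. -/
theorem exists_abs_log_Gamma_add_sub_le {b : ℝ} (hb : 1 ≤ b) :
    ∃ C, 0 < C ∧ ∀ s : ℝ, 0 < s →
      |log (Gamma (s + b)) - ((s + b - 1 / 2) * log s - s + log (2 * π) / 2)| ≤ C / s := by
  refine ⟨8 + (b ^ 2 + b), by positivity, fun s hs => ?_⟩
  have h1 := abs_log_Gamma_sub_stirling_le (s := s + b) (by linarith)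
  have h2 := abs_mul_log_add_sub_le (s := s) (b := b) hs (by linarith) (by linarith)
  have h3 : 8 / (s + b) ≤ 8 / s := by gcongr; linarith
  rw [add_div]
  rw [abs_le] at *
  constructor <;> linarith

/-! ### Riemann sums of unimodal functions. -/

open Set Finset in
/-- A Riemann sum differs from the integral by at most the mesh times a bound for the variation. -/
theorem abs_riemannSum_sub_integral_le {f V : ℝ → ℝ} {x₀ X h : ℝ} (hh : 0 ≤ h)
    (hf : ContinuousOn f (Icc x₀ X))
    (hV : ∀ x ∈ Icc x₀ X, ∀ y ∈ Icc x₀ X, x ≤ y → |f x - f y| ≤ V y - V x) (K : ℕ)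
    (hK : x₀ + h * K ≤ X) :
    |h * ∑ k ∈ range K, f (x₀ + h * k) - ∫ x in x₀..(x₀ + h * K), f x| ≤
      h * (V (x₀ + h * K) - V x₀) := by
  induction K with
  | zero => simp
  | succ K ih =>
    have hle : x₀ + h * K ≤ x₀ + h * (K + 1 : ℕ) := by push_cast; nlinarith
    have hx : x₀ ≤ x₀ + h * K := by nlinarith [mul_nonneg hh (Nat.cast_nonneg (α := ℝ) K)]
    have ih := ih (hle.trans hK)
    have hint {u v : ℝ} (hu : x₀ ≤ u) (huv : u ≤ v) (hv : v ≤ X) :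
        IntervalIntegrable f MeasureTheory.volume u v :=
      (hf.mono (by rw [uIcc_of_le huv]; exact Icc_subset_Icc hu hv)).intervalIntegrable
    rw [← intervalIntegral.integral_add_adjacent_intervals (hint le_rfl hx (hle.trans hK))
      (hint hx hle hK), sum_range_succ]
    have hlast : |h * f (x₀ + h * K) - ∫ x in (x₀ + h * K)..(x₀ + h * (K + 1 : ℕ)), f x| ≤
        h * (V (x₀ + h * (K + 1 : ℕ)) - V (x₀ + h * K)) := by
      have e : h * f (x₀ + h * K) =
          ∫ _x in (x₀ + h * K)..(x₀ + h * (K + 1 : ℕ)), f (x₀ + h * K) := by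
        rw [intervalIntegral.integral_const, smul_eq_mul]; push_cast; ring
      rw [e, ← intervalIntegral.integral_sub (by simp) (hint hx hle hK)]
      have := intervalIntegral.norm_integral_le_of_norm_le_const
        (a := x₀ + h * K) (b := x₀ + h * (K + 1 : ℕ)) (f := fun x => f (x₀ + h * K) - f x)
        (C := V (x₀ + h * (K + 1 : ℕ)) - V (x₀ + h * K)) (fun x hxm => by
          rw [uIoc_of_le hle] at hxm
          have hxX : x ∈ Icc x₀ X := ⟨hx.trans hxm.1.le, hxm.2.trans hK⟩
          have h1 := hV _ ⟨hx, hle.trans hK⟩ x hxX hxm.1.le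
          have h2 := (abs_nonneg _).trans (hV x hxX _ ⟨hx.trans hle, hK⟩ hxm.2)
          rw [Real.norm_eq_abs]; linarith)
      rw [Real.norm_eq_abs] at this
      refine this.trans (le_of_eq ?_)
      rw [show x₀ + h * (K + 1 : ℕ) - (x₀ + h * K) = h by push_cast; ring, abs_of_nonneg hh]
      ring
    rw [abs_le] at *
    constructor <;> nlinarith

open Set in
/-- A unimodal function is controlled by a monotone function of bounded range. -/
theorem QuasiconcaveOn.exists_variation {f : ℝ → ℝ} {u X M : ℝ} (huX : u ≤ X)
    (hf : ContinuousOn f (Icc u X)) (hq : QuasiconcaveOn ℝ (Icc u X) f)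
    (h0 : ∀ x ∈ Icc u X, 0 ≤ f x) (hM : ∀ x ∈ Icc u X, f x ≤ M) :
    ∃ V : ℝ → ℝ, (∀ x ∈ Icc u X, 0 ≤ V x ∧ V x ≤ 2 * M) ∧
      ∀ x ∈ Icc u X, ∀ y ∈ Icc u X, x ≤ y → |f x - f y| ≤ V y - V x := by
  obtain ⟨m, hm, hmax⟩ := isCompact_Icc.exists_isMaxOn ⟨u, left_mem_Icc.2 huX⟩ hf
  have hmax' : ∀ x ∈ Icc u X, f x ≤ f m := fun x hx => hmax hx
  have hup : ∀ x ∈ Icc u X, ∀ y ∈ Icc u X, x ≤ y → y ≤ m → f x ≤ f y := fun x hx y _ hxy hym =>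
    ((hq (f x)).ordConnected.out ⟨hx, le_rfl⟩ ⟨hm, hmax' x hx⟩ ⟨hxy, hym⟩).2
  have hdown : ∀ x ∈ Icc u X, ∀ y ∈ Icc u X, x ≤ y → m ≤ x → f y ≤ f x := fun x _ y hy hxy hmx =>
    ((hq (f y)).ordConnected.out ⟨hm, hmax' y hy⟩ ⟨hy, le_rfl⟩ ⟨hmx, hxy⟩).2
  -- The variation function of `f`: it follows `f` up to the maximum point `m` and then reflects the
  -- descent upwards.
  refine ⟨fun x => if x ≤ m then f x else 2 * f m - f x, fun x hx => ?_, fun x hx y hy hxy => ?_⟩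
  · have := h0 x hx
    have := hmax' x hx
    have := hM m hm
    dsimp only
    split_ifs <;> constructor <;> linarith
  · have h1 := hmax' x hx
    have h2 := hmax' y hy
    dsimp only
    split_ifs with hym hxm hxm
    · have := hup x hx y hy hxy hym
      rw [abs_le]; constructor <;> linarith
    · exact absurd (hxy.trans hym) hxm
    · rw [abs_le]; constructor <;> linarith
    · have := hdown x hx y hy hxy (le_of_not_ge hxm)
      rw [abs_le]; constructor <;> linarith

/-! ### Sums of `Y ^ s / Γ(s + 1)` over arithmetic progressions. -/

/-- The function `s ↦ Y ^ s / Γ(s + 1)`, which interpolates the terms of the exponential series. -/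
noncomputable def powDivGamma (Y s : ℝ) : ℝ := Y ^ s / Real.Gamma (s + 1)

theorem powDivGamma_pos {Y s : ℝ} (hY : 0 < Y) (hs : 0 ≤ s) : 0 < powDivGamma Y s :=
  div_pos (Real.rpow_pos_of_pos hY s) (Real.Gamma_pos_of_pos (by linarith))

theorem powDivGamma_nat (Y : ℝ) (n : ℕ) : powDivGamma Y n = Y ^ n / n.factorial := by
  rw [powDivGamma, Real.Gamma_nat_eq_factorial, Real.rpow_natCast]

theorem powDivGamma_add_one {Y s : ℝ} (hY : 0 < Y) (hs : 0 ≤ s) :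
    powDivGamma Y (s + 1) = powDivGamma Y s * (Y / (s + 1)) := by
  have h1 : s + 1 ≠ 0 := by positivity
  rw [powDivGamma, powDivGamma, Real.Gamma_add_one h1, Real.rpow_add_one hY.ne']
  have := (Real.Gamma_pos_of_pos (by linarith : 0 < s + 1)).ne'
  field_simp

open Real in
theorem log_powDivGamma {Y s : ℝ} (hY : 0 < Y) (hs : 0 ≤ s) :
    log (powDivGamma Y s) = s * log Y - log (Gamma (s + 1)) := by
  rw [powDivGamma, log_div (rpow_pos_of_pos hY s).ne' (Gamma_pos_of_pos (by linarith)).ne',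
    log_rpow hY]

theorem continuousOn_powDivGamma {Y : ℝ} (hY : 0 < Y) : ContinuousOn (powDivGamma Y) (Set.Ici 0) := by
  intro s hs
  have hs : (0 : ℝ) ≤ s := hs
  refine ContinuousAt.continuousWithinAt ?_
  refine (Real.continuousAt_const_rpow hY.ne').div ?_ (Real.Gamma_pos_of_pos (by linarith)).ne'
  have : ContinuousAt Real.Gamma (s + 1) :=
    (Real.differentiableAt_Gamma fun m => by
      have : (0 : ℝ) ≤ m := m.cast_nonneg
      linarith).continuousAt
  exact ContinuousAt.comp (f := fun s : ℝ => s + 1) this (by fun_prop)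

-- Log-convexity of `Γ` makes the function log-concave, so its superlevel sets are convex.
open Real Set in
theorem quasiconcaveOn_powDivGamma {Y : ℝ} (hY : 0 < Y) {u X : ℝ} (hu : 0 ≤ u) :
    QuasiconcaveOn ℝ (Icc u X) (powDivGamma Y) := by
  have hconv : ConvexOn ℝ (Icc u X) fun s => log (Gamma (s + 1)) - s * log Y := by
    have h1 : ConvexOn ℝ (Icc u X) fun s => log (Gamma (s + 1)) := by
      refine ((convexOn_log_Gamma.translate_left 1).subset (fun s hs => ?_) (convex_Icc u X))
      have : (0 : ℝ) < s + 1 := by linarith [hs.1]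
      simp only [Set.mem_preimage, Set.mem_Ioi]
      linarith
    have h2 : ConcaveOn ℝ (Icc u X) fun s => s * log Y :=
      ((LinearMap.id (R := ℝ) (M := ℝ)).smulRight (log Y)).concaveOn (convex_Icc u X)
    exact h1.sub h2
  intro r
  rcases le_or_gt r 0 with hr | hr
  · have : {x | x ∈ Icc u X ∧ r ≤ powDivGamma Y x} = Icc u X := by
      ext x
      exact ⟨fun h => h.1, fun h => ⟨h, hr.trans (powDivGamma_pos hY (hu.trans h.1)).le⟩⟩
    rw [this]; exact convex_Icc u X
  · have : {x | x ∈ Icc u X ∧ r ≤ powDivGamma Y x} =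
        {x | x ∈ Icc u X ∧ log (Gamma (x + 1)) - x * log Y ≤ -log r} := by
      ext x
      refine and_congr_right fun hx => ?_
      rw [← log_le_log_iff hr (powDivGamma_pos hY (hu.trans hx.1)),
        log_powDivGamma hY (hu.trans hx.1)]
      constructor <;> intro h <;> linarith
    rw [this]
    exact hconv.quasiconvexOn (-log r)

open Real in
/-- The maximum of `Y ^ s / Γ(s + 1)` is `O(e ^ Y / √Y)`. -/
theorem exists_powDivGamma_le :
    ∃ C, 0 < C ∧ ∀ Y : ℝ, 2 ≤ Y → ∀ s : ℝ, 0 ≤ s → powDivGamma Y s ≤ C * (exp Y / √Y) := by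
  obtain ⟨C, hC0, hC⟩ := exists_abs_log_Gamma_add_sub_le (b := 1) le_rfl
  refine ⟨exp C * √2, by positivity, fun Y hY => ?_⟩
  have hY0 : 0 < Y := by linarith
  -- For `s ≥ Y / 2` Stirling suffices: `s log (Y / s) - (Y - s) ≤ 0`, and `√s ≥ √(Y / 2)` supplies
  -- the factor `√2`.
  have hbig : ∀ s : ℝ, 0 ≤ s → Y / 2 ≤ s → powDivGamma Y s ≤ exp C * √2 * (exp Y / √Y) := by
    intro s _ hs
    have hs1 : 1 ≤ s := by linarith
    have hs0 : 0 < s := by linarith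
    rw [← log_le_log_iff (powDivGamma_pos hY0 hs0.le) (by positivity), log_powDivGamma hY0 hs0.le,
      log_mul (by positivity) (by positivity), log_mul (by positivity) (by positivity), log_exp,
      log_div (by positivity) (by positivity), log_exp, log_sqrt hY0.le, log_sqrt two_pos.le]
    have h1 := (abs_le.1 (hC s hs0)).1
    have h2 : C / s ≤ C := div_le_self hC0.le hs1
    have h3 : s * (log Y - log s) ≤ Y - s := by
      rw [← log_div hY0.ne' hs0.ne']
      have := mul_le_mul_of_nonneg_left (log_le_sub_one_of_pos (div_pos hY0 hs0)) hs0.le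
      have e : s * (Y / s - 1) = Y - s := by field_simp
      linarith
    have h4 : log Y - log 2 ≤ log s := by
      rw [← log_div hY0.ne' two_ne_zero]; exact log_le_log (by positivity) hs
    have h5 : 0 ≤ log (2 * π) := log_nonneg (by nlinarith [pi_gt_three])
    nlinarith
  -- Below `Y / 2` the ratio `Y / (s + 1)` of values at `s + 1` and `s` is at least `1`, because `Y
  -- ≥ 2`; unit steps to the right reach the range of `hbig`.
  have hall : ∀ n : ℕ, ∀ s : ℝ, 0 ≤ s → Y / 2 - s ≤ n →
      powDivGamma Y s ≤ exp C * √2 * (exp Y / √Y) := by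
    intro n
    induction n with
    | zero => intro s hs h; exact hbig s hs (by simp at h; linarith)
    | succ n ih =>
      intro s hs h
      rcases le_or_gt (Y / 2) s with h' | h'
      · exact hbig s hs h'
      · refine le_trans ?_ (ih (s + 1) (by linarith) (by push_cast at h; linarith))
        rw [powDivGamma_add_one hY0 hs]
        refine le_mul_of_one_le_right (powDivGamma_pos hY0 hs).le ?_
        rw [one_le_div (by linarith)]; linarith
  intro s hs
  exact hall ⌈Y / 2 - s⌉₊ s hs (Nat.le_ceil _)

-- Sums with step `α` and with step `1` approximate the same integral, up to a multiple of the
-- maximum. The step-`1` sum from `0` is the exponential series, so the integral over the half-line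
-- never has to be evaluated.
open Real Finset Filter Topology in
theorem exists_abs_sum_powDivGamma_sub_le {α b : ℝ} (hα : 0 < α) (hb : 0 ≤ b) :
    ∃ C, 0 < C ∧ ∀ Y : ℝ, 2 ≤ Y → Summable (fun k : ℕ => powDivGamma Y (b + α * k)) ∧
      |α * ∑' k : ℕ, powDivGamma Y (b + α * k) - exp Y| ≤ C * (exp Y / √Y) := by
  obtain ⟨C, hC0, hC⟩ := exists_powDivGamma_le
  refine ⟨(2 * α + 3 + b) * C, by positivity, fun Y hY => ?_⟩
  have hY0 : 0 < Y := by linarith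
  set M := C * (exp Y / √Y) with hMdef
  have hM0 : 0 < M := by positivity
  have hpos (k : ℕ) : 0 ≤ powDivGamma Y (b + α * k) := (powDivGamma_pos hY0 (by positivity)).le
  have hcont {u X : ℝ} (hu : 0 ≤ u) : ContinuousOn (powDivGamma Y) (Set.Icc u X) :=
    (continuousOn_powDivGamma hY0).mono fun x hx => hu.trans hx.1
  have hint {u v : ℝ} (hu : 0 ≤ u) (hv : 0 ≤ v) :
      IntervalIntegrable (powDivGamma Y) MeasureTheory.volume u v :=
    ((continuousOn_powDivGamma hY0).mono fun x hx => (le_min hu hv).trans hx.1).intervalIntegrable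
  have hbound {u v : ℝ} (hu : 0 ≤ u) (huv : u ≤ v) :
      |∫ x in u..v, powDivGamma Y x| ≤ M * (v - u) := by
    have := intervalIntegral.norm_integral_le_of_norm_le_const (a := u) (b := v)
      (f := powDivGamma Y) (C := M) (fun x hx => by
        rw [Set.uIoc_of_le huv] at hx
        have hx0 : 0 ≤ x := hu.trans hx.1.le
        rw [norm_eq_abs, abs_of_pos (powDivGamma_pos hY0 hx0)]
        exact hC Y hY x hx0)
    rwa [norm_eq_abs, abs_of_nonneg (sub_nonneg.2 huv)] at this
  have hsum {u h : ℝ} (hu : 0 ≤ u) (hh : 0 ≤ h) (K : ℕ) :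
      |h * ∑ k ∈ range K, powDivGamma Y (u + h * k) - ∫ x in u..(u + h * K), powDivGamma Y x| ≤
        h * (2 * M) := by
    have hX : u ≤ u + h * K := by nlinarith [mul_nonneg hh (Nat.cast_nonneg (α := ℝ) K)]
    obtain ⟨V, hV1, hV2⟩ := (quasiconcaveOn_powDivGamma hY0 hu).exists_variation hX (hcont hu)
      (M := M) (fun x hx => (powDivGamma_pos hY0 (hu.trans hx.1)).le)
      (fun x hx => hC Y hY x (hu.trans hx.1))
    refine (abs_riemannSum_sub_integral_le hh (hcont hu) hV2 K le_rfl).trans ?_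
    have h1 := (hV1 _ (Set.left_mem_Icc.2 hX)).1
    have h2 := (hV1 _ (Set.right_mem_Icc.2 hX)).2
    exact mul_le_mul_of_nonneg_left (by linarith) hh
  -- In units of `M` the errors are `2 α` and `2` for the two Riemann sums, `b` for the integral
  -- over `[0, b]`, and `1` for the integral from `⌊X⌋` to `X`.
  have hmain (K : ℕ) : |α * ∑ k ∈ range K, powDivGamma Y (b + α * k) -
      ∑ n ∈ range ⌊b + α * K⌋₊, powDivGamma Y n| ≤ (2 * α + 3 + b) * M := by
    set X := b + α * K with hX
    have hX0 : 0 ≤ X := by positivity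
    have h1 := hsum hb hα.le K
    have h2 := hsum le_rfl zero_le_one ⌊X⌋₊
    simp only [zero_add, one_mul] at h2
    have hfl := Nat.floor_le hX0
    have hfl' := Nat.lt_floor_add_one X
    have hn0 : (0 : ℝ) ≤ ⌊X⌋₊ := Nat.cast_nonneg _
    have h3 := hbound hn0 hfl
    have h4 := hbound le_rfl hb
    have e1 := intervalIntegral.integral_add_adjacent_intervals (hint le_rfl hb) (hint hb hX0)
    have e2 := intervalIntegral.integral_add_adjacent_intervals (hint le_rfl hn0) (hint hn0 hX0)
    rw [← hX] at h1
    rw [abs_le] at *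
    constructor <;> nlinarith
  have hexp : HasSum (fun n : ℕ => powDivGamma Y n) (exp Y) := by
    simp_rw [powDivGamma_nat]
    rw [exp_eq_exp_ℝ]
    exact NormedSpace.expSeries_div_hasSum_exp Y
  have hsm : Summable (fun k : ℕ => powDivGamma Y (b + α * k)) := by
    refine summable_of_sum_range_le (c := (exp Y + (2 * α + 3 + b) * M) / α) hpos fun K => ?_
    rw [le_div_iff₀ hα]
    have h1 := (abs_le.1 (hmain K)).2
    have h2 := hexp.summable.sum_le_tsum (range ⌊b + α * K⌋₊)
      (fun n _ => (powDivGamma_pos hY0 n.cast_nonneg).le)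
    rw [hexp.tsum_eq] at h2
    linarith
  refine ⟨hsm, ?_⟩
  have hN : Tendsto (fun K : ℕ => ⌊b + α * (K : ℝ)⌋₊) atTop atTop :=
    tendsto_nat_floor_atTop.comp
      (tendsto_atTop_add_const_left _ _ (tendsto_natCast_atTop_atTop.const_mul_atTop hα))
  have hlim := ((hsm.hasSum.tendsto_sum_nat.const_mul α).sub
    (hexp.tendsto_sum_nat.comp hN)).abs
  rw [mul_assoc]
  exact le_of_tendsto' hlim hmain

/-! ### The Wright function and its asymptotics. -/

/-- The Wright function `φ(a, 1; x) = ∑ x ^ k / (k! Γ(a k + 1))`. -/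
noncomputable def wright (a x : ℝ) : ℝ :=
  ∑' k : ℕ, x ^ k / (k.factorial * Real.Gamma (a * k + 1))

theorem Gamma_wright_pos {a : ℝ} (ha : 0 < a) (k : ℕ) : 0 < Real.Gamma (a * k + 1) :=
  Real.Gamma_pos_of_pos (by positivity)

open Real in
theorem summable_wright {a : ℝ} (ha : 0 < a) (x : ℝ) :
    Summable fun k : ℕ => x ^ k / (k.factorial * Gamma (a * k + 1)) := by
  -- The positive minimum of `Γ` on the half-line allows domination by the exponential series.
  obtain ⟨y, hy, hmin⟩ := exists_isMinOn_Gamma_Ioi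
  have hy0 : 0 < Gamma y := Gamma_pos_of_pos (by linarith [hy.1])
  refine Summable.of_norm_bounded (g := fun k : ℕ => |x| ^ k / k.factorial * (Gamma y)⁻¹)
    ((summable_pow_div_factorial |x|).mul_right _) fun k => ?_
  have h1 : Gamma y ≤ Gamma (a * k + 1) := hmin (by simp only [Set.mem_Ioi]; positivity)
  rw [norm_div, norm_pow, norm_mul, norm_eq_abs, norm_of_nonneg (hy0.trans_le h1).le,
    norm_of_nonneg (by positivity : (0 : ℝ) ≤ k.factorial), ← div_eq_mul_inv, div_div]
  gcongr

theorem wright_term_nonneg {a x : ℝ} (ha : 0 < a) (hx : 0 ≤ x) (k : ℕ) :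
    0 ≤ x ^ k / (k.factorial * Real.Gamma (a * k + 1)) :=
  div_nonneg (by positivity) (mul_nonneg (by positivity) (Gamma_wright_pos ha k).le)

theorem wright_mono {a x y : ℝ} (ha : 0 < a) (hx : 0 ≤ x) (hxy : x ≤ y) :
    wright a x ≤ wright a y := by
  refine (summable_wright ha x).tsum_le_tsum (fun k => ?_) (summable_wright ha y)
  have := Gamma_wright_pos ha k
  gcongr

theorem one_le_wright {a x : ℝ} (ha : 0 < a) (hx : 0 ≤ x) : 1 ≤ wright a x := by
  have := (summable_wright ha x).le_tsum 0 fun k _ => wright_term_nonneg ha hx k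
  simpa [wright] using this

open Real in
theorem abs_exp_sub_one_le_mul_exp (x : ℝ) : |exp x - 1| ≤ |x| * exp |x| := by
  have h1 := add_one_le_exp x
  have h2 := add_one_le_exp (-x)
  rcases le_total 0 x with h | h
  · have := one_le_exp h
    rw [abs_of_nonneg (by linarith), abs_of_nonneg h]
    have h3 : exp (-x) * exp x = 1 := by rw [← exp_add]; simp
    nlinarith [exp_pos x]
  · have := exp_le_one_iff.2 h
    rw [abs_of_nonpos (by linarith), abs_of_nonpos h]
    have := one_le_exp (neg_nonneg.2 h)
    nlinarith

open Real in
/-- Comparison of `k! Γ(a k + 1)` with a single Gamma function. -/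
theorem exists_abs_Gamma_div_sub_le {a : ℝ} (ha : 0 < a) :
    ∃ C, 0 < C ∧ ∀ k : ℕ,
      |Gamma ((1 + a) * k + 3 / 2) /
          (k.factorial * Gamma (a * k + 1) * ((1 + a) ^ (1 + a) / a ^ a) ^ k) -
        (1 + a) / √(2 * π * a)| ≤ C / (k + 1) := by
  -- The shift `3/2` makes the powers of `k` cancel: both sides carry `k ^ ((1 + a) k + 1)`.
  obtain ⟨C₁, hC₁, h₁⟩ := exists_abs_log_Gamma_add_sub_le (b := 3 / 2) (by norm_num)
  obtain ⟨C₂, hC₂, h₂⟩ := exists_abs_log_Gamma_add_sub_le (b := 1) le_rfl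
  set A := (1 + a) / √(2 * π * a) with hA
  have hA0 : 0 < A := by positivity
  set D := C₁ / (1 + a) + C₂ + C₂ / a with hD
  have hD0 : 0 < D := by positivity
  set q : ℕ → ℝ := fun k => Gamma ((1 + a) * k + 3 / 2) /
          (k.factorial * Gamma (a * k + 1) * ((1 + a) ^ (1 + a) / a ^ a) ^ k) with hq
  have hr0 : 0 < (1 + a) ^ (1 + a) / a ^ a := by positivity
  have hG1 (k : ℕ) : 0 < Gamma ((1 + a) * k + 3 / 2) := Gamma_pos_of_pos (by positivity)
  have hG2 (k : ℕ) := Gamma_wright_pos ha k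
  have hq0 (k : ℕ) : 0 < q k := by
    have := hG1 k
    have := hG2 k
    positivity
  have hlogA : log A = log (1 + a) - (log (2 * π) + log a) / 2 := by
    rw [hA, log_div (by positivity) (by positivity), log_sqrt (by positivity),
      log_mul (by positivity) ha.ne']
  have hlog (k : ℕ) (hk : k ≠ 0) : |log (q k / A)| ≤ D / k := by
    have hk0 : (0 : ℝ) < k := by positivity
    have e1 := h₁ ((1 + a) * k) (by positivity)
    have e2 := h₂ (a * k) (by positivity)
    have e3 := h₂ k hk0
    rw [Gamma_nat_eq_factorial] at e3
    have hl : log (q k) = log (Gamma ((1 + a) * k + 3 / 2)) - (log k.factorial +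
        log (Gamma (a * k + 1)) + k * ((1 + a) * log (1 + a) - a * log a)) := by
      have := (hG1 k).ne'
      have := (hG2 k).ne'
      rw [hq]
      dsimp only
      rw [log_div (by positivity) (by positivity), log_mul (by positivity) (by positivity),
        log_mul (by positivity) (by positivity), log_pow, log_div (by positivity) (by positivity),
        log_rpow (by positivity), log_rpow ha]
    have s1 : C₁ / ((1 + a) * k) = C₁ / (1 + a) / k := by rw [div_div]
    have s2 : C₂ / (a * k) = C₂ / a / k := by rw [div_div]
    have s3 : D / k = C₁ / (1 + a) / k + C₂ / k + C₂ / a / k := by rw [hD, add_div, add_div]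
    rw [log_div (hq0 k).ne' hA0.ne', hl, hlogA, s3]
    rw [s1, log_mul (by positivity) hk0.ne'] at e1
    rw [s2, log_mul ha.ne' hk0.ne'] at e2
    rw [abs_le] at *
    constructor <;> nlinarith
  -- The first summand serves `k ≥ 1`, where `D / k ≤ 2 D / (k + 1)`; the second serves `k = 0`,
  -- where Stirling's bound says nothing.
  refine ⟨A * (2 * D * exp D) + |q 0 - A|, by positivity, fun k => ?_⟩
  change |q k - A| ≤ _
  rcases eq_or_ne k 0 with rfl | hk
  · simp only [Nat.cast_zero, zero_add, div_one]
    have : 0 < A * (2 * D * exp D) := by positivity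
    linarith
  · have hk1 : (1 : ℝ) ≤ k := by exact_mod_cast Nat.one_le_iff_ne_zero.2 hk
    have hk0 : (0 : ℝ) < k := by linarith
    have e : q k - A = A * (exp (log (q k / A)) - 1) := by
      rw [exp_log (div_pos (hq0 k) hA0)]; field_simp
    have h1 : |log (q k / A)| ≤ D := (hlog k hk).trans (div_le_self hD0.le hk1)
    have h2 := abs_exp_sub_one_le_mul_exp (log (q k / A))
    have h3 : |log (q k / A)| * exp |log (q k / A)| ≤ D / k * exp D := by
      gcongr
      exact hlog k hk
    have h4 : D / k * exp D ≤ 2 * D * exp D / (k + 1) := by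
      rw [div_mul_eq_mul_div, div_le_div_iff₀ hk0 (by positivity)]
      nlinarith [mul_pos hD0 (exp_pos D)]
    rw [e, abs_mul, abs_of_pos hA0, add_div, mul_div_assoc]
    have h5 : 0 ≤ |q 0 - A| / (k + 1) := by positivity
    have := mul_le_mul_of_nonneg_left (h2.trans (h3.trans h4)) hA0.le
    linarith

open Real in
/-- The asymptotics of the Wright function on the positive half-line. -/
theorem exists_abs_wright_sub_le {a : ℝ} (ha : 0 < a) :
    ∃ C, 0 < C ∧ ∀ Y : ℝ, 2 ≤ Y → ∀ x : ℝ, (1 + a) ^ (1 + a) / a ^ a * x = Y ^ (1 + a) →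
      |wright a x - exp Y / √(2 * π * a * Y)| ≤ C * (exp Y / √(2 * π * a * Y)) / √Y := by
  obtain ⟨C₀, hC₀, h₀⟩ := exists_abs_Gamma_div_sub_le ha
  have hα : 0 < 1 + a := by positivity
  obtain ⟨C₁, hC₁, h₁⟩ := exists_abs_sum_powDivGamma_sub_le hα (b := 1 / 2) (by norm_num)
  obtain ⟨C₂, hC₂, h₂⟩ := exists_abs_sum_powDivGamma_sub_le hα (b := 3 / 2) (by norm_num)
  set B := √(2 * π * a) with hB
  have hB0 : 0 < B := by positivity
  set r := (1 + a) ^ (1 + a) / a ^ a with hr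
  have hr0 : 0 < r := by positivity
  refine ⟨C₁ + B * (C₀ * (1 + a + 3 / 2) * ((1 + C₂) / (1 + a))), by positivity,
    fun Y hY x hx => ?_⟩
  have hY0 : 0 < Y := by linarith
  have hsq : √(2 * π * a * Y) = B * √Y := by rw [hB, ← sqrt_mul (by positivity)]
  have hsY : 1 ≤ √Y := by rw [one_le_sqrt]; linarith
  have hsY2 : √Y * √Y = Y := mul_self_sqrt hY0.le
  obtain ⟨hs₁, hb₁⟩ := h₁ Y hY
  obtain ⟨hs₂, hb₂⟩ := h₂ Y hY
  set q : ℕ → ℝ := fun k => Gamma ((1 + a) * k + 3 / 2) /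
          (k.factorial * Gamma (a * k + 1) * r ^ k) with hq
  have hterm (k : ℕ) : x ^ k / (k.factorial * Gamma (a * k + 1)) =
      q k * (powDivGamma Y (1 / 2 + (1 + a) * k) / √Y) := by
    have hG1 : Gamma ((1 + a) * k + 3 / 2) ≠ 0 := (Gamma_pos_of_pos (by positivity)).ne'
    have hG2 := (Gamma_wright_pos ha k).ne'
    have e1 : powDivGamma Y (1 / 2 + (1 + a) * k) =
        √Y * (r * x) ^ k / Gamma ((1 + a) * k + 3 / 2) := by
      rw [powDivGamma, rpow_add hY0, ← sqrt_eq_rpow, rpow_mul hY0.le, ← hx, rpow_natCast]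
      ring_nf
    rw [e1, hq, mul_pow]
    have : √Y ≠ 0 := by positivity
    field_simp
  -- The relative error `1 / (k + 1)` is absorbed by raising the index by one, via
  -- `powDivGamma_add_one`. This costs a factor `1 / Y` and explains the second progression,
  -- starting at `3/2`.
  have hdiff (k : ℕ) : |x ^ k / (k.factorial * Gamma (a * k + 1)) -
      (1 + a) / B * (powDivGamma Y (1 / 2 + (1 + a) * k) / √Y)| ≤
      C₀ * (1 + a + 3 / 2) / (Y * √Y) * powDivGamma Y (3 / 2 + (1 + a) * k) := by
    have hp : 0 < powDivGamma Y (1 / 2 + (1 + a) * k) := powDivGamma_pos hY0 (by positivity)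
    have e1 : powDivGamma Y (3 / 2 + (1 + a) * k) =
        powDivGamma Y (1 / 2 + (1 + a) * k) * (Y / (1 / 2 + (1 + a) * k + 1)) := by
      rw [← powDivGamma_add_one hY0 (by positivity)]; ring_nf
    rw [hterm, ← sub_mul, abs_mul, abs_of_pos (by positivity : 0 < powDivGamma Y _ / √Y), e1]
    refine (mul_le_mul_of_nonneg_right (h₀ k) (by positivity)).trans ?_
    have e2 : C₀ * (1 + a + 3 / 2) / (Y * √Y) *
        (powDivGamma Y (1 / 2 + (1 + a) * k) * (Y / (1 / 2 + (1 + a) * k + 1))) =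
        C₀ * (1 + a + 3 / 2) / (1 / 2 + (1 + a) * k + 1) *
          (powDivGamma Y (1 / 2 + (1 + a) * k) / √Y) := by
      field_simp
    rw [e2]
    refine mul_le_mul_of_nonneg_right ?_ (by positivity)
    rw [div_le_div_iff₀ (by positivity) (by positivity), mul_assoc]
    refine mul_le_mul_of_nonneg_left ?_ hC₀.le
    have : (0 : ℝ) ≤ k := k.cast_nonneg
    nlinarith
  have hS1 := (hs₁.div_const (√Y)).mul_left ((1 + a) / B)
  have hS2 := hs₂.mul_left (C₀ * (1 + a + 3 / 2) / (Y * √Y))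
  have hmain : |wright a x - (1 + a) / B *
      ((∑' k : ℕ, powDivGamma Y (1 / 2 + (1 + a) * k)) / √Y)| ≤
      C₀ * (1 + a + 3 / 2) / (Y * √Y) * ∑' k : ℕ, powDivGamma Y (3 / 2 + (1 + a) * k) := by
    rw [← tsum_div_const, ← tsum_mul_left, ← tsum_mul_left, wright,
      ← (summable_wright ha x).tsum_sub hS1]
    exact tsum_of_norm_bounded hS2.hasSum fun k => (norm_eq_abs _).trans_le (hdiff k)
  have hle2 : (∑' k : ℕ, powDivGamma Y (3 / 2 + (1 + a) * k)) ≤ (1 + C₂) / (1 + a) * exp Y := by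
    have h3 := (abs_le.1 hb₂).2
    have h4 : C₂ * (exp Y / √Y) ≤ C₂ * exp Y :=
      mul_le_mul_of_nonneg_left (div_le_self (exp_pos Y).le hsY) hC₂.le
    rw [div_mul_eq_mul_div, le_div_iff₀ hα]
    nlinarith
  have hmain2 : |(1 + a) / B * ((∑' k : ℕ, powDivGamma Y (1 / 2 + (1 + a) * k)) / √Y) -
      exp Y / (B * √Y)| ≤ 1 / (B * √Y) * (C₁ * (exp Y / √Y)) := by
    have e : (1 + a) / B * ((∑' k : ℕ, powDivGamma Y (1 / 2 + (1 + a) * k)) / √Y) -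
      exp Y / (B * √Y) = 1 / (B * √Y) *
        ((1 + a) * (∑' k : ℕ, powDivGamma Y (1 / 2 + (1 + a) * k)) - exp Y) := by
      field_simp
    rw [e, abs_mul, abs_of_pos (by positivity)]
    exact mul_le_mul_of_nonneg_left hb₁ (by positivity)
  rw [hsq]
  refine (abs_sub_le _ _ _).trans ((add_le_add hmain hmain2).trans ?_)
  have h5 : C₀ * (1 + a + 3 / 2) / (Y * √Y) * ∑' k : ℕ, powDivGamma Y (3 / 2 + (1 + a) * k) ≤
      C₀ * (1 + a + 3 / 2) / (√Y * √Y) * ((1 + C₂) / (1 + a) * exp Y) := by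
    have hle : √Y * √Y ≤ Y * √Y := by nlinarith
    have hnn : 0 ≤ ∑' k : ℕ, powDivGamma Y (3 / 2 + (1 + a) * k) :=
      tsum_nonneg fun k => (powDivGamma_pos hY0 (by positivity)).le
    gcongr
  refine (add_le_add_left h5 _).trans (le_of_eq ?_)
  field_simp
  ring

/-! ### The Laplace transform. -/

open Real MeasureTheory Set in
/-- The Laplace transform of `t ↦ φ(a, 1; c t ^ a)`. -/
theorem integral_wright_mul_exp {a c m : ℝ} (ha : 0 < a) (hc : 0 < c) (hm : 0 < m) :
    ∫ t in Ioi (0 : ℝ), wright a (c * t ^ a) * exp (-(m * t)) = exp (c * m ^ (-a)) / m := by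
  set F : ℕ → ℝ → ℝ := fun k t =>
    (c * t ^ a) ^ k / (k.factorial * Gamma (a * k + 1)) * exp (-(m * t)) with hF
  have hF0 (k : ℕ) {t : ℝ} (ht : t ∈ Ioi (0 : ℝ)) : 0 ≤ F k t :=
    mul_nonneg (wright_term_nonneg ha (mul_nonneg hc.le (rpow_nonneg (le_of_lt ht) a)) k)
      (exp_pos _).le
  have hint (k : ℕ) : ∫ t in Ioi (0 : ℝ), F k t = (c * m ^ (-a)) ^ k / k.factorial / m := by
    have hG := Gamma_wright_pos ha k
    have e : ∀ t ∈ Ioi (0 : ℝ), F k t = c ^ k / (k.factorial * Gamma (a * k + 1)) *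
        (t ^ (a * k + 1 - 1) * exp (-(m * t))) := fun t ht => by
      simp only [hF]
      rw [mul_pow, add_sub_cancel_right, rpow_mul (le_of_lt ht), rpow_natCast]
      ring
    rw [setIntegral_congr_fun measurableSet_Ioi e, integral_const_mul,
      integral_rpow_mul_exp_neg_mul_Ioi (by positivity) hm, one_div, inv_rpow hm.le, rpow_add hm,
      rpow_one, mul_pow, rpow_neg hm.le, inv_pow, ← rpow_natCast (m ^ a), ← rpow_mul hm.le]
    have : m ^ (a * k) ≠ 0 := by positivity
    field_simp
  have hpos (k : ℕ) : 0 < (c * m ^ (-a)) ^ k / k.factorial / m := by positivity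
  have hFint (k : ℕ) : Integrable (F k) (volume.restrict (Ioi 0)) := by
    -- A nonintegrable function has integral `0` by convention, whereas this integral is positive.
    by_contra h
    exact (hpos k).ne' ((hint k).symm.trans (integral_undef h))
  have hsum := (NormedSpace.expSeries_div_hasSum_exp (c * m ^ (-a))).div_const m
  rw [← exp_eq_exp_ℝ] at hsum
  have hnorm (k : ℕ) : ∫ t in Ioi (0 : ℝ), ‖F k t‖ = ∫ t in Ioi (0 : ℝ), F k t :=
    setIntegral_congr_fun measurableSet_Ioi fun t ht => norm_of_nonneg (hF0 k ht)
  have key := hasSum_integral_of_summable_integral_norm hFint (by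
    simp_rw [hnorm, hint]; exact hsum.summable)
  simp_rw [hint] at key
  rw [hsum.unique key]
  refine integral_congr_ae (ae_of_all _ fun t => ?_)
  simp only [hF, wright]
  rw [tsum_mul_right]

open Real MeasureTheory Set in
theorem integrableOn_wright_mul_exp {a c m : ℝ} (ha : 0 < a) (hc : 0 < c) (hm : 0 < m) :
    IntegrableOn (fun t => wright a (c * t ^ a) * exp (-(m * t))) (Ioi 0) := by
  by_contra h
  have h1 := integral_wright_mul_exp ha hc hm
  rw [integral_undef h] at h1
  exact absurd h1 (by positivity)

/-! ### The integral representation and the analytic continuation. -/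

open MeasureTheory Set in
/-- An integral representation of the generalized exponential, valid in the cut plane. -/
noncomputable def wrightIntegral (c a : ℝ) (z : ℂ) : ℂ :=
  -∫ t in Ioi (0 : ℝ), ((wright a (c * t ^ a) * Real.exp (-(1 * t)) : ℝ) : ℂ) *
    (z / (1 + z * (Real.exp (-t) : ℝ)) ^ 2)

theorem isOpen_cutPlane : IsOpen cutPlane :=
  Complex.isOpen_slitPlane.union Metric.isOpen_ball

theorem isPreconnected_cutPlane : IsPreconnected cutPlane := by
  refine IsPreconnected.union (1 / 2) ?_ ?_ ?_ (convex_ball _ _).isPreconnected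
  · simp [Complex.mem_slitPlane_iff]
  · simp only [Metric.mem_ball, dist_zero_right]; norm_num
  · exact (Complex.starConvex_one_slitPlane.isPathConnected
      Complex.one_mem_slitPlane).isConnected.isPreconnected

theorem one_add_mul_ne_zero_of_mem_cutPlane {z : ℂ} (hz : z ∈ cutPlane) {s : ℝ} (h0 : 0 ≤ s)
    (h1 : s ≤ 1) : 1 + z * (s : ℂ) ≠ 0 := by
  intro h
  rcases hz with hz | hz
  · have hre := congrArg Complex.re h
    have him := congrArg Complex.im h
    simp at hre him
    have hs : s ≠ 0 := by rintro rfl; simp at hre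
    rcases Complex.mem_slitPlane_iff.1 hz with h2 | h2
    · nlinarith
    · exact him.elim h2 hs
  · rw [Metric.mem_ball, dist_zero_right] at hz
    have : ‖z * (s : ℂ)‖ = 1 := by
      rw [eq_neg_of_add_eq_zero_right h]; simp
    rw [norm_mul, Complex.norm_real, Real.norm_of_nonneg h0] at this
    nlinarith [norm_nonneg z]

-- The bound is uniform in a neighbourhood of `z₀`, as needed to dominate the derivative of the
-- integrand in `z`.
open Set in
theorem exists_le_norm_one_add_mul {z₀ : ℂ} (hz : z₀ ∈ cutPlane) :
    ∃ d, 0 < d ∧ ∀ z ∈ Metric.ball z₀ d, ∀ s ∈ Icc (0 : ℝ) 1, d ≤ ‖1 + z * (s : ℂ)‖ := by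
  obtain ⟨s₀, hs₀, hmin⟩ := (isCompact_Icc (a := (0 : ℝ)) (b := 1)).exists_isMinOn
    ⟨0, by simp⟩ (f := fun s : ℝ => ‖1 + z₀ * (s : ℂ)‖) (by fun_prop)
  have hd : 0 < ‖1 + z₀ * (s₀ : ℂ)‖ :=
    norm_pos_iff.2 (one_add_mul_ne_zero_of_mem_cutPlane hz hs₀.1 hs₀.2)
  refine ⟨‖1 + z₀ * (s₀ : ℂ)‖ / 2, by positivity, fun z hz s hs => ?_⟩
  have h1 : ‖1 + z₀ * (s₀ : ℂ)‖ ≤ ‖1 + z₀ * (s : ℂ)‖ := hmin hs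
  rw [Metric.mem_ball, dist_eq_norm] at hz
  have h2 : ‖1 + z₀ * (s : ℂ)‖ ≤ ‖1 + z * (s : ℂ)‖ + ‖(z - z₀) * (s : ℂ)‖ := by
    have : 1 + z₀ * (s : ℂ) = 1 + z * (s : ℂ) - (z - z₀) * (s : ℂ) := by ring
    rw [this]; exact norm_sub_le _ _
  have h3 : ‖(z - z₀) * (s : ℂ)‖ ≤ ‖z - z₀‖ := by
    rw [norm_mul, Complex.norm_real, Real.norm_of_nonneg hs.1]
    exact mul_le_of_le_one_right (norm_nonneg _) hs.2
  linarith

open Set in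
theorem exp_neg_mem_Icc {t : ℝ} (ht : 0 < t) : Real.exp (-t) ∈ Icc (0 : ℝ) 1 :=
  ⟨(Real.exp_pos _).le, Real.exp_le_one_iff.2 (by linarith)⟩

open MeasureTheory Set in
theorem aestronglyMeasurable_kernel (z : ℂ) (n : ℕ) (p : ℝ → ℂ) (hp : Continuous p) :
    AEStronglyMeasurable (fun t : ℝ => p t / (1 + z * (Real.exp (-t) : ℝ)) ^ n)
      (volume.restrict (Ioi 0)) := by
  refine Measurable.aestronglyMeasurable ?_
  exact hp.measurable.div (by fun_prop)

open MeasureTheory Set in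
theorem integrableOn_wrightIntegrand {c a : ℝ} (ha : 0 < a) (hc : 0 < c) {z : ℂ}
    (hz : z ∈ cutPlane) :
    IntegrableOn (fun t : ℝ => ((wright a (c * t ^ a) * Real.exp (-(1 * t)) : ℝ) : ℂ) *
      (z / (1 + z * (Real.exp (-t) : ℝ)) ^ 2)) (Ioi 0) := by
  obtain ⟨d, hd, hdz⟩ := exists_le_norm_one_add_mul hz
  refine Integrable.mul_bdd (c := ‖z‖ / d ^ 2)
    (integrableOn_wright_mul_exp ha hc one_pos).ofReal
    (aestronglyMeasurable_kernel z 2 (fun _ => z) continuous_const) ?_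
  refine (ae_restrict_mem measurableSet_Ioi).mono fun t ht => ?_
  have := hdz z (Metric.mem_ball_self hd) _ (exp_neg_mem_Icc ht)
  rw [norm_div, norm_pow]
  gcongr

open MeasureTheory Set in
theorem differentiableAt_wrightIntegral {c a : ℝ} (ha : 0 < a) (hc : 0 < c) {z₀ : ℂ}
    (hz : z₀ ∈ cutPlane) : DifferentiableAt ℂ (wrightIntegral c a) z₀ := by
  obtain ⟨d, hd, hdz⟩ := exists_le_norm_one_add_mul hz
  have hw := (integrableOn_wright_mul_exp ha hc one_pos).ofReal (𝕜 := ℂ)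
  have hmeas (z : ℂ) := hw.1.mul (aestronglyMeasurable_kernel z 2 (fun _ => z) continuous_const)
  refine DifferentiableAt.neg ?_
  refine (hasDerivAt_integral_of_dominated_loc_of_deriv_le (μ := volume.restrict (Ioi (0 : ℝ)))
    (F' := fun z t => ((wright a (c * t ^ a) * Real.exp (-(1 * t)) : ℝ) : ℂ) *
      ((1 - z * (Real.exp (-t) : ℝ)) / (1 + z * (Real.exp (-t) : ℝ)) ^ 3))
    (bound := fun t => wright a (c * t ^ a) * Real.exp (-(1 * t)) * ((1 + (‖z₀‖ + d)) / d ^ 3))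
    (Metric.ball_mem_nhds z₀ hd) (Filter.Eventually.of_forall hmeas)
    (integrableOn_wrightIntegrand ha hc hz)
    (hw.1.mul (aestronglyMeasurable_kernel z₀ 3 _ (by fun_prop))) ?_
    ((integrableOn_wright_mul_exp ha hc one_pos).mul_const _) ?_).2.differentiableAt
  · refine (ae_restrict_mem measurableSet_Ioi).mono fun t ht z hzb => ?_
    have ht' := exp_neg_mem_Icc ht
    have h1 := hdz z hzb _ ht'
    have hwr : 0 ≤ wright a (c * t ^ a) :=
      zero_le_one.trans (one_le_wright ha (mul_nonneg hc.le (Real.rpow_nonneg (le_of_lt ht) a)))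
    rw [norm_mul, Complex.norm_real, Real.norm_of_nonneg (by positivity), norm_div, norm_pow]
    have h2 : ‖1 - z * (Real.exp (-t) : ℝ)‖ ≤ 1 + (‖z₀‖ + d) := by
      refine (norm_sub_le _ _).trans ?_
      rw [norm_one, norm_mul, Complex.norm_real, Real.norm_of_nonneg ht'.1]
      have h3 : ‖z‖ ≤ ‖z₀‖ + d := by
        rw [Metric.mem_ball, dist_eq_norm] at hzb
        have := norm_le_norm_add_norm_sub' z z₀
        linarith
      have := mul_le_of_le_one_right (norm_nonneg z) ht'.2
      linarith
    gcongr
  · refine (ae_restrict_mem measurableSet_Ioi).mono fun t ht z hzb => ?_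
    have hne : 1 + z * (Real.exp (-t) : ℝ) ≠ 0 :=
      norm_pos_iff.1 (hd.trans_le (hdz z hzb _ (exp_neg_mem_Icc ht)))
    have h1 : HasDerivAt (fun z : ℂ => 1 + z * (Real.exp (-t) : ℝ)) (Real.exp (-t) : ℝ) z := by
      simpa using ((hasDerivAt_id z).mul_const ((Real.exp (-t) : ℝ) : ℂ)).const_add 1
    have h2 : HasDerivAt (fun z : ℂ => z / (1 + z * (Real.exp (-t) : ℝ)) ^ 2)
        ((1 - z * (Real.exp (-t) : ℝ)) / (1 + z * (Real.exp (-t) : ℝ)) ^ 3) z := by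
      refine ((hasDerivAt_id z).div (h1.pow 2) (pow_ne_zero 2 hne)).congr_deriv ?_
      simp only [id, Pi.pow_apply]
      field_simp
      push_cast
      ring
    exact h2.const_mul _

open MeasureTheory Set in
theorem hasSum_wrightIntegral {c a : ℝ} (ha : 0 < a) (hc : 0 < c) {z : ℂ} (hz : ‖z‖ < 1) :
    HasSum (fun n : ℕ => (Real.exp (c * ((n + 1 : ℕ) : ℝ) ^ (-a)) : ℂ) * (-z) ^ (n + 1))
      (wrightIntegral c a z) := by
  -- The factor `n + 1` cancels the division by `m = n + 1` in the Laplace transform.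
  set F : ℕ → ℝ → ℂ := fun n t =>
    ((wright a (c * t ^ a) * Real.exp (-(((n + 1 : ℕ) : ℝ) * t)) : ℝ) : ℂ) *
      (((n + 1 : ℕ) : ℂ) * (-z) ^ (n + 1)) with hF
  have hn (n : ℕ) : (0 : ℝ) < (n + 1 : ℕ) := by positivity
  have hFint (n : ℕ) : Integrable (F n) (volume.restrict (Ioi 0)) :=
    (integrableOn_wright_mul_exp ha hc (hn n)).ofReal.mul_const _
  have hI (n : ℕ) : ∫ t in Ioi (0 : ℝ), F n t =
      (Real.exp (c * ((n + 1 : ℕ) : ℝ) ^ (-a)) : ℂ) * (-z) ^ (n + 1) := by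
    rw [integral_mul_const, integral_complex_ofReal, integral_wright_mul_exp ha hc (hn n)]
    have : ((n + 1 : ℕ) : ℂ) ≠ 0 := Nat.cast_ne_zero.2 n.succ_ne_zero
    rw [Complex.ofReal_div, Complex.ofReal_natCast]
    field_simp
  have hN (n : ℕ) : ∫ t in Ioi (0 : ℝ), ‖F n t‖ =
      Real.exp (c * ((n + 1 : ℕ) : ℝ) ^ (-a)) * ‖z‖ ^ (n + 1) := by
    have e : ∀ t ∈ Ioi (0 : ℝ), ‖F n t‖ =
        wright a (c * t ^ a) * Real.exp (-(((n + 1 : ℕ) : ℝ) * t)) *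
          (((n + 1 : ℕ) : ℝ) * ‖z‖ ^ (n + 1)) := fun t ht => by
      have hwr : 0 ≤ wright a (c * t ^ a) :=
        zero_le_one.trans (one_le_wright ha (mul_nonneg hc.le (Real.rpow_nonneg (le_of_lt ht) a)))
      simp only [hF]
      rw [norm_mul, Complex.norm_real, Real.norm_of_nonneg (by positivity), norm_mul, norm_pow,
        norm_neg, Complex.norm_natCast]
    rw [setIntegral_congr_fun measurableSet_Ioi e, integral_mul_const,
      integral_wright_mul_exp ha hc (hn n)]
    have := (hn n).ne'
    field_simp
  have hsum : Summable fun n => ∫ t in Ioi (0 : ℝ), ‖F n t‖ := by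
    simp_rw [hN]
    refine Summable.of_nonneg_of_le (fun n => by positivity) (fun n => ?_)
      (((summable_geometric_of_lt_one (norm_nonneg z) hz).comp_injective
        (add_left_injective 1)).mul_left (Real.exp c))
    have h1 : ((n + 1 : ℕ) : ℝ) ^ (-a) ≤ 1 :=
      Real.rpow_le_one_of_one_le_of_nonpos (by push_cast; linarith [n.cast_nonneg (α := ℝ)])
        (by linarith)
    simp only [Function.comp_apply]
    gcongr
    nlinarith
  have key := hasSum_integral_of_summable_integral_norm hFint hsum
  simp_rw [hI] at key
  suffices h : wrightIntegral c a z = ∫ t in Ioi (0 : ℝ), ∑' n, F n t by rwa [h]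
  rw [wrightIntegral, ← integral_neg]
  refine setIntegral_congr_fun measurableSet_Ioi fun t ht => ?_
  have hlt : ‖-z * (Real.exp (-t) : ℝ)‖ < 1 := by
    have := exp_neg_mem_Icc ht
    rw [norm_mul, norm_neg, Complex.norm_real, Real.norm_of_nonneg this.1]
    nlinarith [norm_nonneg z, this.2]
  have h1 := hasSum_coe_mul_geometric_of_norm_lt_one hlt
  -- The series `∑ n w ^ n` has zero term at `n = 0`, so it may start at `1`.
  rw [← hasSum_nat_add_iff' 1] at h1
  have h2 := (h1.mul_left ((wright a (c * t ^ a) : ℝ) : ℂ)).tsum_eq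
  have h3 (n : ℕ) : F n t = ((wright a (c * t ^ a) : ℝ) : ℂ) *
      (((n + 1 : ℕ) : ℂ) * (-z * (Real.exp (-t) : ℝ)) ^ (n + 1)) := by
    have e : Real.exp (-(((n + 1 : ℕ) : ℝ) * t)) = Real.exp (-t) ^ (n + 1) := by
      rw [← Real.exp_nat_mul]; ring_nf
    simp only [hF]
    rw [e, mul_pow]
    push_cast
    ring
  simp_rw [h3]
  rw [h2]
  simp
  ring

/-- The integral representation provides the analytic continuation. -/
theorem isGeneralizedExp_wrightIntegral {c a : ℝ} (ha : 0 < a) (hc : 0 < c) :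
    IsGeneralizedExp c (-a) (wrightIntegral c a) where
  analytic := DifferentiableOn.analyticOnNhd
    (fun _ hz => (differentiableAt_wrightIntegral ha hc hz).differentiableWithinAt) isOpen_cutPlane
  hasSum _ hz := hasSum_wrightIntegral ha hc hz

theorem IsGeneralizedExp.eqOn {c θ : ℝ} {E F : ℂ → ℂ} (hE : IsGeneralizedExp c θ E)
    (hF : IsGeneralizedExp c θ F) : Set.EqOn E F cutPlane := by
  refine hE.analytic.eqOn_of_preconnected_of_eventuallyEq hF.analytic isPreconnected_cutPlane
    (z₀ := 0) (Or.inr (by simp)) ?_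
  filter_upwards [Metric.ball_mem_nhds (0 : ℂ) one_pos] with z hz
  rw [Metric.mem_ball, dist_zero_right] at hz
  exact (hE.hasSum z hz).unique (hF.hasSum z hz)

/-! ### Slow variation of the main term. -/

/-- The exponent `K w ^ β - (β / 2) log w` of the main term. -/
noncomputable def saddleExponent (K β : ℝ) (w : ℂ) : ℂ :=
  (K : ℂ) * w ^ (β : ℂ) - ((β / 2 : ℝ) : ℂ) * Complex.log w

open Real in
theorem exp_saddleExponent_ofReal (K β : ℝ) {t : ℝ} (ht : 0 < t) :
    Complex.exp (saddleExponent K β t) = ((t ^ (-(β / 2)) * exp (K * t ^ β) : ℝ) : ℂ) := by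
  rw [rpow_def_of_pos ht, ← exp_add, Complex.ofReal_exp, saddleExponent,
    ← Complex.ofReal_cpow ht.le, ← Complex.ofReal_log ht.le]
  congr 1
  push_cast
  ring

theorem norm_exp_sub_one_le_mul_exp (w : ℂ) : ‖Complex.exp w - 1‖ ≤ ‖w‖ * Real.exp ‖w‖ := by
  simpa using Complex.norm_exp_sub_sum_le_norm_mul_exp w 1

-- Mean value inequality on the convex half-plane `y ≤ re w`, where the derivative is `O(y ^ (β -
-- 1))`.
open Real in
theorem norm_saddleExponent_sub_le {K β : ℝ} (hK : 0 < K) (hβ : 0 < β) (hβ1 : β < 1) {y : ℝ}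
    (hy : 1 ≤ y) {u v : ℂ} (hu : y ≤ u.re) (hv : y ≤ v.re) :
    ‖saddleExponent K β u - saddleExponent K β v‖ ≤ (K * β + β / 2) * y ^ (β - 1) * ‖u - v‖ := by
  have hconv : Convex ℝ {w : ℂ | y ≤ w.re} := convex_halfSpace_re_ge y
  refine hconv.norm_image_sub_le_of_norm_hasDerivWithin_le
    (f' := fun w => (K : ℂ) * ((β : ℂ) * w ^ ((β : ℂ) - 1) * 1) - ((β / 2 : ℝ) : ℂ) * w⁻¹)
    (fun w hw => ?_) (fun w hw => ?_) hv hu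
  · have hw0 : w ∈ Complex.slitPlane := Or.inl (by linarith [show y ≤ w.re from hw])
    exact ((((hasDerivAt_id w).cpow_const hw0).const_mul _).sub
      ((Complex.hasDerivAt_log hw0).const_mul _)).hasDerivWithinAt
  · have hyw : y ≤ w.re := hw
    have hnw : y ≤ ‖w‖ := hyw.trans ((le_abs_self _).trans (Complex.abs_re_le_norm w))
    have hy0 : 0 < y := by linarith
    have hw0 : w ≠ 0 := norm_pos_iff.1 (hy0.trans_le hnw)
    have e1 : ‖w ^ ((β : ℂ) - 1)‖ ≤ y ^ (β - 1) := by
      have : ((β : ℂ) - 1) = ((β - 1 : ℝ) : ℂ) := by push_cast; ring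
      rw [this, Complex.norm_cpow_real]
      exact rpow_le_rpow_of_nonpos hy0 hnw (by linarith)
    have e2 : ‖w⁻¹‖ ≤ y ^ (β - 1) := by
      rw [norm_inv]
      calc ‖w‖⁻¹ ≤ y⁻¹ := inv_anti₀ hy0 hnw
        _ = y ^ (-1 : ℝ) := (rpow_neg_one y).symm
        _ ≤ y ^ (β - 1) := rpow_le_rpow_of_exponent_le hy (by linarith)
    refine (norm_sub_le _ _).trans ?_
    rw [mul_one, norm_mul, norm_mul, norm_mul, Complex.norm_real, Complex.norm_real,
      Complex.norm_real, norm_of_nonneg hK.le, norm_of_nonneg hβ.le,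
      norm_of_nonneg (by positivity)]
    have h1 := mul_le_mul_of_nonneg_left e1 (by positivity : 0 ≤ K * β)
    have h2 := mul_le_mul_of_nonneg_left e2 (by positivity : 0 ≤ β / 2)
    linarith

open Real in
/-- A monotone function asymptotic to the main term on the positive half-line varies slowly,
also in comparison with the main term near the half-line. -/
theorem exists_norm_div_sub_one_le {G : ℝ → ℝ} {K₁ K β C₀ T : ℝ} (hK₁ : 0 < K₁) (hK : 0 < K)
    (hβ : 0 < β) (hβ1 : β < 1) (hC₀ : 0 ≤ C₀) (hG0 : ∀ t, 0 < t → 0 ≤ G t)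
    (hGm : ∀ t s, 0 < t → t ≤ s → G t ≤ G s)
    (hG : ∀ t, T ≤ t →
      |G t / (K₁ * (t ^ (-(β / 2)) * exp (K * t ^ β))) - 1| ≤ C₀ * t ^ (-(β / 2))) :
    ∃ C X, 0 < C ∧ 1 ≤ X ∧ ∀ L : ℂ, X ≤ L.re → |L.im| ≤ π → ∀ t : ℝ, 0 < t →
      ‖(G t : ℂ) / (K₁ * Complex.exp (saddleExponent K β L)) - 1‖ ≤
        C * L.re ^ (-(min (β / 2) (1 - β))) * exp (3 / 4 * |t - L.re|) := by
  set ν := min (β / 2) (1 - β) with hν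
  have hν1 : ν ≤ β / 2 := min_le_left _ _
  have hν2 : ν ≤ 1 - β := min_le_right _ _
  set D := 2 * (K * β + β / 2) with hD
  have hD0 : 0 < D := by positivity
  have hlim : Tendsto (fun x : ℝ => D * x ^ (β - 1)) atTop (nhds 0) := by
    have := (tendsto_rpow_neg_atTop (by linarith : 0 < 1 - β)).const_mul D
    simpa [neg_sub] using this
  -- With `1 / 4`, the two exponentials `exp ((u + π) / 4)` used below multiply to at most `e^π exp
  -- (3 u / 4)`, which grows more slowly than the kernel decays.
  obtain ⟨X₁, hX₁⟩ := eventually_atTop.1 (hlim.eventually (ge_mem_nhds (by norm_num : (0 : ℝ) < 1 / 4)))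
  set P := exp π with hP
  have hP1 : 1 ≤ P := one_le_exp pi_pos.le
  set C₁ := 2 * C₀ * P + 4 * D * P with hC₁
  have hC₁0 : 0 < C₁ := by positivity
  have main : ∀ L : ℂ, max (max X₁ (2 * T)) 2 ≤ L.re → |L.im| ≤ π → ∀ t : ℝ, L.re / 2 ≤ t →
      ‖(G t : ℂ) / (K₁ * Complex.exp (saddleExponent K β L)) - 1‖ ≤
        C₁ * L.re ^ (-ν) * exp (3 / 4 * |t - L.re|) := by
    intro L hL hLi t ht
    have hLX : X₁ ≤ L.re := ((le_max_left _ _).trans (le_max_left _ _)).trans hL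
    have hLT : 2 * T ≤ L.re := ((le_max_right _ _).trans (le_max_left _ _)).trans hL
    have hL2 : 2 ≤ L.re := (le_max_right _ _).trans hL
    set x := L.re with hx
    set u := |t - x| with hu
    have hu0 : 0 ≤ u := abs_nonneg _
    have ht0 : 0 < t := by linarith
    have hx0 : 0 < x := by linarith
    set δ := saddleExponent K β t - saddleExponent K β L with hδ
    have hhalf {p : ℝ} (hp0 : 0 ≤ p) (hp : p ≤ 1) : (x / 2) ^ (-p) ≤ 2 * x ^ (-p) := by
      rw [div_rpow hx0.le two_pos.le, rpow_neg two_pos.le, div_inv_eq_mul, mul_comm]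
      gcongr
      calc (2 : ℝ) ^ p ≤ 2 ^ (1 : ℝ) := rpow_le_rpow_of_exponent_le one_le_two hp
        _ = 2 := rpow_one 2
    have hdist : ‖(t : ℂ) - L‖ ≤ u + π := by
      refine (Complex.norm_le_abs_re_add_abs_im _).trans ?_
      simp only [Complex.sub_re, Complex.ofReal_re, Complex.sub_im, Complex.ofReal_im, zero_sub,
        abs_neg]
      exact add_le_add le_rfl hLi
    have hδ1 : ‖δ‖ ≤ D * x ^ (β - 1) * (u + π) := by
      refine (norm_saddleExponent_sub_le hK hβ hβ1 (y := x / 2) (by linarith) (by simpa using ht)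
        (by linarith : x / 2 ≤ L.re)).trans ?_
      have h1 := hhalf (p := 1 - β) (by linarith) (by linarith)
      rw [neg_sub] at h1
      have h2 : (K * β + β / 2) * (x / 2) ^ (β - 1) ≤ D * x ^ (β - 1) := by
        rw [hD]
        have := mul_le_mul_of_nonneg_left h1 (by positivity : 0 ≤ K * β + β / 2)
        linarith
      gcongr
    have hq := hX₁ x hLX
    have hδ2 : ‖δ‖ ≤ (u + π) / 4 := by
      refine hδ1.trans ?_
      have := mul_le_mul_of_nonneg_right hq (by positivity : 0 ≤ u + π)
      linarith
    have hE : exp ((u + π) / 4) * exp ((u + π) / 4) ≤ P * exp (3 / 4 * u) := by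
      rw [← exp_add, hP, ← exp_add]
      exact exp_le_exp.2 (by linarith [pi_pos])
    have hE1 : exp ((u + π) / 4) ≤ P * exp (3 / 4 * u) := by
      rw [hP, ← exp_add]
      exact exp_le_exp.2 (by linarith [pi_pos])
    have hexp : ‖Complex.exp δ‖ ≤ P * exp (3 / 4 * u) :=
      (Complex.norm_exp_le_exp_norm δ).trans ((exp_le_exp.2 hδ2).trans hE1)
    have hexp1 : ‖Complex.exp δ - 1‖ ≤ 4 * D * P * x ^ (-ν) * exp (3 / 4 * u) := by
      refine (norm_exp_sub_one_le_mul_exp δ).trans ?_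
      have h1 : u + π ≤ 4 * exp ((u + π) / 4) := by linarith [add_one_le_exp ((u + π) / 4)]
      calc ‖δ‖ * exp ‖δ‖ ≤ (D * x ^ (β - 1) * (4 * exp ((u + π) / 4))) * exp ((u + π) / 4) := by
            gcongr
            exact hδ1.trans (by gcongr)
        _ = 4 * D * x ^ (β - 1) * (exp ((u + π) / 4) * exp ((u + π) / 4)) := by ring
        _ ≤ 4 * D * x ^ (-ν) * (P * exp (3 / 4 * u)) := by
            gcongr
            · linarith
            · linarith
        _ = _ := by ring
    have hreal : |G t / (K₁ * (t ^ (-(β / 2)) * exp (K * t ^ β))) - 1| ≤ 2 * C₀ * x ^ (-ν) := by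
      refine (hG t (by linarith)).trans ?_
      calc C₀ * t ^ (-(β / 2)) ≤ C₀ * (2 * x ^ (-(β / 2))) := by
            refine mul_le_mul_of_nonneg_left ?_ hC₀
            exact (rpow_le_rpow_of_nonpos (by positivity) ht (by linarith)).trans
              (hhalf (by linarith) (by linarith))
        _ ≤ C₀ * (2 * x ^ (-ν)) := by
            gcongr
            linarith
        _ = _ := by ring
    have hm0 : (K₁ : ℂ) * Complex.exp (saddleExponent K β t) ≠ 0 :=
      mul_ne_zero (Complex.ofReal_ne_zero.2 hK₁.ne') (Complex.exp_ne_zero _)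
    have e1 : (G t : ℂ) / (K₁ * Complex.exp (saddleExponent K β L)) =
        (G t : ℂ) / (K₁ * Complex.exp (saddleExponent K β t)) * Complex.exp δ := by
      rw [hδ, Complex.exp_sub]
      have := Complex.exp_ne_zero (saddleExponent K β L)
      have := Complex.exp_ne_zero (saddleExponent K β t)
      have : (K₁ : ℂ) ≠ 0 := Complex.ofReal_ne_zero.2 hK₁.ne'
      field_simp
    have e2 : (G t : ℂ) / (K₁ * Complex.exp (saddleExponent K β t)) - 1 =
        ((G t / (K₁ * (t ^ (-(β / 2)) * exp (K * t ^ β))) - 1 : ℝ) : ℂ) := by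
      rw [exp_saddleExponent_ofReal K β ht0]
      push_cast
      ring
    -- This separates the asymptotic error of `G`, giving `β / 2`, from the displacement of `t` to
    -- `L`, giving `1 - β`.
    have e3 : (G t : ℂ) / (K₁ * Complex.exp (saddleExponent K β L)) - 1 =
        ((G t : ℂ) / (K₁ * Complex.exp (saddleExponent K β t)) - 1) * Complex.exp δ +
          (Complex.exp δ - 1) := by
      rw [e1]; ring
    rw [e3, e2]
    refine (norm_add_le _ _).trans ?_
    rw [norm_mul, Complex.norm_real, norm_eq_abs]
    have h3 := mul_le_mul hreal hexp (norm_nonneg _) (by positivity)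
    refine (add_le_add h3 hexp1).trans (le_of_eq ?_)
    rw [hC₁]
    ring
  refine ⟨C₁ + 4 * (C₁ + 2), max (max X₁ (2 * T)) 2, by positivity,
    one_le_two.trans (le_max_right _ _), fun L hL hLi t ht => ?_⟩
  have hL2 : 2 ≤ L.re := (le_max_right _ _).trans hL
  have hx0 : 0 < L.re := by linarith
  have hpos : 0 < L.re ^ (-ν) * exp (3 / 4 * |t - L.re|) := by positivity
  rcases le_or_gt (L.re / 2) t with h | h
  · refine (main L hL hLi t h).trans ?_
    nlinarith
  -- For `t < re L / 2` the asymptotics may be unavailable; monotonicity bounds the ratio by its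
  -- value at `re L`. The factor `exp (3/4 * |t - re L|) ≥ re L / 4` then outweighs the loss of `(re
  -- L) ^ (-ν)`, as `ν ≤ 1`.
  · set Z := (K₁ : ℂ) * Complex.exp (saddleExponent K β L) with hZ
    have h1 := main L hL hLi L.re (by linarith)
    rw [sub_self, abs_zero, mul_zero, exp_zero, mul_one] at h1
    have hx1 : L.re ^ (-ν) ≤ 1 := rpow_le_one_of_one_le_of_nonpos (by linarith)
      (neg_nonpos.2 (le_min (by linarith) (by linarith)))
    have h2 : ‖(G L.re : ℂ) / Z‖ ≤ C₁ + 1 := by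
      have h3 := norm_le_norm_add_norm_sub' ((G L.re : ℂ) / Z) 1
      rw [norm_one] at h3
      nlinarith
    have h3 : ‖(G t : ℂ) / Z‖ ≤ C₁ + 1 := by
      refine le_trans ?_ h2
      rw [norm_div, norm_div, Complex.norm_real, Complex.norm_real, norm_of_nonneg (hG0 t ht),
        norm_of_nonneg (hG0 _ hx0)]
      gcongr
      exact hGm t _ ht (by linarith)
    have h4 : 1 ≤ 4 * (L.re ^ (-ν) * exp (3 / 4 * |t - L.re|)) := by
      have h5 : L.re⁻¹ ≤ L.re ^ (-ν) := by
        rw [← rpow_neg_one]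
        exact rpow_le_rpow_of_exponent_le (by linarith) (by linarith)
      have h6 : L.re / 4 ≤ exp (3 / 4 * |t - L.re|) := by
        have := add_one_le_exp (3 / 4 * |t - L.re|)
        have := neg_le_abs (t - L.re)
        linarith
      have h7 := mul_le_mul h5 h6 (by positivity) (by positivity)
      have h8 : L.re⁻¹ * (L.re / 4) = 1 / 4 := by field_simp
      linarith
    have h9 : ‖(G t : ℂ) / Z - 1‖ ≤ C₁ + 2 := by
      refine (norm_sub_le _ _).trans ?_
      rw [norm_one]
      linarith
    refine h9.trans ?_
    nlinarith

/-! ### Size and mass of the kernel. -/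

open Real MeasureTheory in
theorem integral_exp_neg_abs_div_four : ∫ s : ℝ, exp (-(|s| / 4)) = 8 := by
  rw [integral_comp_abs (f := fun s => exp (-(s / 4)))]
  have := integral_exp_mul_Ioi (a := -(1 / 4)) (by norm_num) 0
  have e : (fun s : ℝ => exp (-(s / 4))) = fun s => exp (-(1 / 4) * s) := by
    ext s; ring_nf
  rw [e, this]
  norm_num

open Real MeasureTheory in
theorem integrable_exp_neg_abs_div_four : Integrable fun s : ℝ => exp (-(|s| / 4)) := by
  by_contra h
  have := integral_exp_neg_abs_div_four
  rw [integral_undef h] at this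
  norm_num at this

open Real in
/-- In a sector, `1 + z s` is comparable with `1 + ‖z‖ s`. -/
theorem mul_sq_le_norm_one_add_mul_sq {δ : ℝ} (hδ0 : 0 < δ) {z : ℂ} (hz : |z.arg| ≤ π - δ) {s : ℝ}
    (hs : 0 ≤ s) : (1 - cos δ) / 2 * (1 + ‖z‖ * s) ^ 2 ≤ ‖1 + z * (s : ℂ)‖ ^ 2 := by
  have h1 : -cos δ ≤ cos z.arg := by
    rw [← cos_pi_sub, ← cos_abs z.arg]
    exact cos_le_cos_of_nonneg_of_le_pi (abs_nonneg _) (by linarith) hz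
  have h2 : ‖1 + z * (s : ℂ)‖ ^ 2 = 1 + 2 * s * z.re + s ^ 2 * ‖z‖ ^ 2 := by
    rw [← Complex.normSq_eq_norm_sq, ← Complex.normSq_eq_norm_sq, Complex.normSq_apply,
      Complex.normSq_apply]
    simp
    ring
  have h3 : z.re = ‖z‖ * cos z.arg := (Complex.norm_mul_cos_arg z).symm
  have h4 : -(‖z‖ * cos δ) ≤ z.re := by
    rw [h3, ← mul_neg]; exact mul_le_mul_of_nonneg_left h1 (norm_nonneg z)
  have h5 := mul_le_mul_of_nonneg_left h4 (by positivity : 0 ≤ 2 * s)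
  rw [h2]
  -- With `cos δ` replacing `-cos (arg z)`, the two sides differ by exactly `(1 + cos δ) / 2 * (1 -
  -- ‖z‖ s)²`.
  nlinarith [mul_nonneg (by linarith [neg_one_le_cos δ] : 0 ≤ 1 + cos δ)
    (sq_nonneg (1 - ‖z‖ * s))]

/-- The kernel of the integral representation. -/
noncomputable def wrightKernel (z : ℂ) (t : ℝ) : ℂ :=
  (Real.exp (-t) : ℝ) * (z / (1 + z * (Real.exp (-t) : ℝ)) ^ 2)

open Real in
theorem norm_wrightKernel_le {δ : ℝ} (hδ0 : 0 < δ) (hδ : δ ≤ π) {z : ℂ} (hz0 : z ≠ 0)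
    (hz : |z.arg| ≤ π - δ) (t : ℝ) :
    ‖wrightKernel z t‖ ≤ 2 / (1 - cos δ) * exp (-|t - log ‖z‖|) := by
  have hκ : 0 < 1 - cos δ := by
    have := cos_lt_cos_of_nonneg_of_le_pi le_rfl hδ hδ0
    rw [cos_zero] at this
    linarith
  have hn := norm_pos_iff.2 hz0
  have h1 := mul_sq_le_norm_one_add_mul_sq hδ0 hz (exp_pos (-t)).le
  have hp : ‖z‖ * exp (-t) = exp (-(t - log ‖z‖)) := by
    rw [neg_sub, sub_eq_add_neg, exp_add, exp_log hn]
  set p := exp (-(t - log ‖z‖)) with hpdef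
  have hp0 : 0 < p := exp_pos _
  have hpos : 0 < (1 - cos δ) / 2 * (1 + ‖z‖ * exp (-t)) ^ 2 := by positivity
  have h2 : ‖wrightKernel z t‖ = p / ‖1 + z * (exp (-t) : ℝ)‖ ^ 2 := by
    rw [wrightKernel, norm_mul, norm_div, norm_pow, Complex.norm_real,
      norm_of_nonneg (exp_pos _).le, ← hp]
    ring
  -- The left side is at most both `p` and `1 / p`.
  have h3 : p / (1 + p) ^ 2 ≤ exp (-|t - log ‖z‖|) := by
    rw [div_le_iff₀ (by positivity)]
    rcases le_total 0 (t - log ‖z‖) with h | h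
    · rw [abs_of_nonneg h, ← hpdef]
      exact le_mul_of_one_le_right hp0.le (by nlinarith)
    · have : exp (-|t - log ‖z‖|) * p = 1 := by
        rw [abs_of_nonpos h, hpdef, ← exp_add]; simp
      nlinarith [exp_pos (-|t - log ‖z‖|)]
  rw [h2]
  calc p / ‖1 + z * (exp (-t) : ℝ)‖ ^ 2 ≤ p / ((1 - cos δ) / 2 * (1 + ‖z‖ * exp (-t)) ^ 2) := by
        gcongr
    _ = 2 / (1 - cos δ) * (p / (1 + p) ^ 2) := by rw [hp]; field_simp
    _ ≤ _ := by gcongr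

open MeasureTheory Set Topology in
theorem integrableOn_wrightKernel {z : ℂ} (hz : z ∈ cutPlane) :
    IntegrableOn (wrightKernel z) (Ioi 0) := by
  obtain ⟨d, hd, hdz⟩ := exists_le_norm_one_add_mul hz
  refine Integrable.mul_bdd (c := ‖z‖ / d ^ 2) (integrableOn_exp_neg_Ioi 0).ofReal
    (aestronglyMeasurable_kernel z 2 (fun _ => z) continuous_const) ?_
  refine (ae_restrict_mem measurableSet_Ioi).mono fun t ht => ?_
  have := hdz z (Metric.mem_ball_self hd) _ (exp_neg_mem_Icc ht)
  rw [norm_div, norm_pow]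
  gcongr

-- The kernel is the `t`-derivative of `(1 + z e^{-t})⁻¹`.
open MeasureTheory Set Topology in
theorem integral_wrightKernel {z : ℂ} (hz : z ∈ cutPlane) :
    ∫ t in Ioi (0 : ℝ), wrightKernel z t = 1 - (1 + z)⁻¹ := by
  have hlim : Tendsto (fun t : ℝ => (1 + z * (Real.exp (-t) : ℝ))⁻¹) atTop (𝓝 1) := by
    have h1 : Tendsto (fun t : ℝ => ((Real.exp (-t) : ℝ) : ℂ)) atTop (𝓝 ((0 : ℝ) : ℂ)) :=
      (Complex.continuous_ofReal.tendsto 0).comp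
        (Real.tendsto_exp_atBot.comp tendsto_neg_atTop_atBot)
    have h2 := ((h1.const_mul z).const_add 1).inv₀ (by simp)
    simpa using h2
  have := integral_Ioi_of_hasDerivAt_of_tendsto' (a := (0 : ℝ)) (fun t ht => ?_)
    (integrableOn_wrightKernel hz) hlim
  · simpa using this
  · have ht0 : 0 ≤ t := ht
    have hne := one_add_mul_ne_zero_of_mem_cutPlane hz (Real.exp_pos (-t)).le
      (Real.exp_le_one_iff.2 (by linarith))
    have h1 : HasDerivAt (fun t : ℝ => ((Real.exp (-t) : ℝ) : ℂ)) ((-Real.exp (-t) : ℝ) : ℂ) t := by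
      have : HasDerivAt (fun t : ℝ => Real.exp (-t)) (-Real.exp (-t)) t := by
        simpa using (hasDerivAt_neg t).exp
      exact this.ofReal_comp
    refine (((h1.const_mul z).const_add 1).inv hne).congr_deriv ?_
    rw [wrightKernel]
    push_cast
    ring

/-! ### Matching the constants `K₁` and `K₂`. -/

open Real in
theorem saddleK1_neg_pos {c a : ℝ} (ha : 0 < a) (hc : 0 < c) : 0 < saddleK1 c (-a) := by
  have h1 : 0 < -(c * -a) := by nlinarith [mul_pos hc ha]
  have h2 : 0 < 1 - -a := by linarith
  unfold saddleK1
  positivity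

open Real in
theorem saddleK2_neg_pos {c a : ℝ} (ha : 0 < a) (hc : 0 < c) : 0 < saddleK2 c (-a) := by
  have h1 : 0 < -(c * -a) := by nlinarith [mul_pos hc ha]
  have h2 : 0 < 1 - 1 / -a := by
    have : 0 < 1 / a := by positivity
    rw [div_neg]; linarith
  unfold saddleK2
  positivity

-- This identifies the parameter of the Wright asymptotics at `x = c t ^ a` as `Y = K₂ t ^ β`.
open Real in
theorem saddleK2_neg_rpow {c a : ℝ} (ha : 0 < a) (hc : 0 < c) {t : ℝ} (ht : 0 < t) :
    (1 + a) ^ (1 + a) / a ^ a * (c * t ^ a) = (saddleK2 c (-a) * t ^ (a / (1 + a))) ^ (1 + a) := by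
  have h1 : 0 < 1 + a := by positivity
  have e1 : saddleK2 c (-a) = (1 + a) / a * (c * a) ^ (1 / (1 + a)) := by
    unfold saddleK2
    rw [sub_neg_eq_add, mul_neg, neg_neg]
    congr 1
    field_simp
    ring
  rw [e1, mul_rpow (by positivity) (by positivity), mul_rpow (by positivity) (by positivity),
    ← rpow_mul (by positivity), ← rpow_mul (by positivity), div_mul_cancel₀ _ h1.ne',
    div_mul_cancel₀ _ h1.ne', rpow_one, div_rpow h1.le ha.le, rpow_add ha, rpow_one]
  have : a ^ a ≠ 0 := by positivity
  field_simp

open Real in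
theorem inv_sqrt_eq_saddleK1_mul {c a : ℝ} (ha : 0 < a) (hc : 0 < c) {t : ℝ} (ht : 0 < t) :
    1 / √(2 * π * a * (saddleK2 c (-a) * t ^ (a / (1 + a)))) =
      saddleK1 c (-a) * t ^ (-(a / (1 + a) / 2)) := by
  have h1 : 0 < 1 + a := by positivity
  have e1 : 2 * π * a * (saddleK2 c (-a) * t ^ (a / (1 + a))) =
      2 * π * (1 - -a) * (-(c * -a)) ^ (1 / (1 - -a)) * t ^ (a / (1 + a)) := by
    unfold saddleK2
    field_simp
    ring
  have h2 : 0 < -(c * -a) := by nlinarith [mul_pos hc ha]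
  have h3 : 0 < 1 - -a := by linarith
  rw [e1, sqrt_eq_rpow, one_div, ← rpow_neg (by positivity), mul_rpow (by positivity) (by positivity),
    mul_rpow (by positivity) (by positivity), ← rpow_mul (by positivity), ← rpow_mul (by positivity),
    saddleK1]
  congr 2
  · congr 1
    rw [sub_neg_eq_add, show 2 * (-a - 1) = -(2 * (1 + a)) by ring, div_neg]
    field_simp
  · ring

open Real in
theorem exists_abs_wright_div_sub_one_le {a c : ℝ} (ha : 0 < a) (hc : 0 < c) :
    ∃ C T, 0 ≤ C ∧ ∀ t : ℝ, T ≤ t →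
      |wright a (c * t ^ a) / (saddleK1 c (-a) * (t ^ (-(a / (1 + a) / 2)) *
        exp (saddleK2 c (-a) * t ^ (a / (1 + a))))) - 1| ≤ C * t ^ (-(a / (1 + a) / 2)) := by
  obtain ⟨C, hC, h⟩ := exists_abs_wright_sub_le ha
  have hK := saddleK2_neg_pos ha hc
  set K := saddleK2 c (-a) with hKdef
  have hβ : 0 < a / (1 + a) := by positivity
  obtain ⟨T, hT⟩ := eventually_atTop.1
    (((tendsto_rpow_atTop hβ).const_mul_atTop hK).eventually_ge_atTop 2)
  refine ⟨C / √K, max T 1, by positivity, fun t ht => ?_⟩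
  have ht0 : 0 < t := by linarith [le_max_right T 1]
  have hY := hT t ((le_max_left _ _).trans ht)
  have h1 := h _ hY _ (saddleK2_neg_rpow ha hc ht0)
  have e := inv_sqrt_eq_saddleK1_mul ha hc ht0
  rw [← hKdef] at e
  have e2 : exp (K * t ^ (a / (1 + a))) / √(2 * π * a * (K * t ^ (a / (1 + a)))) =
      saddleK1 c (-a) * (t ^ (-(a / (1 + a) / 2)) * exp (K * t ^ (a / (1 + a)))) := by
    rw [← mul_assoc (saddleK1 c (-a)), ← e]; ring
  rw [e2] at h1
  have hm : 0 < saddleK1 c (-a) * (t ^ (-(a / (1 + a) / 2)) * exp (K * t ^ (a / (1 + a)))) := by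
    have := saddleK1_neg_pos ha hc
    positivity
  have e3 : (√(K * t ^ (a / (1 + a))))⁻¹ = t ^ (-(a / (1 + a) / 2)) / √K := by
    rw [sqrt_mul hK.le, sqrt_eq_rpow (t ^ (a / (1 + a))), ← rpow_mul ht0.le, rpow_neg ht0.le,
      mul_inv, mul_one_div]
    ring
  rw [div_sub_one hm.ne', abs_div, abs_of_pos hm, div_le_iff₀ hm]
  refine h1.trans (le_of_eq ?_)
  rw [div_eq_mul_inv, e3]
  ring

theorem saddleMain_neg_eq {c a : ℝ} (ha : 0 < a) {z : ℂ} (hz : Complex.log z ≠ 0) :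
    saddleMain c (-a) z = -((saddleK1 c (-a) : ℂ) *
      Complex.exp (saddleExponent (saddleK2 c (-a)) (a / (1 + a)) (Complex.log z))) := by
  have h1 : (1 + a) ≠ 0 := by positivity
  have e1 : -a / (2 * (1 - -a)) = -(a / (1 + a) / 2) := by
    rw [sub_neg_eq_add]; field_simp
  have e2 : -a / (-a - 1) = a / (1 + a) := by
    rw [← neg_add', add_comm a 1, neg_div_neg_eq]
  rw [saddleMain, e1, e2, saddleExponent, Complex.exp_sub, Complex.cpow_def_of_ne_zero hz,
    mul_comm (Complex.log (Complex.log z)), Complex.ofReal_neg]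
  simp only [neg_mul, Complex.exp_neg, div_eq_mul_inv]
  ring

/-! ### The asymptotic formula. -/

open Real MeasureTheory Set in
/-- The asymptotic formula for the integral representation, with an explicit form of the error. -/
theorem exists_norm_wrightIntegral_div_sub_one_le {c a δ : ℝ} (ha : 0 < a) (hc : 0 < c)
    (hδ0 : 0 < δ) (hδ : δ ≤ π) :
    ∃ C X, 1 ≤ X ∧ ∀ z : ℂ, X ≤ log ‖z‖ → |z.arg| ≤ π - δ →
      ‖wrightIntegral c a z / saddleMain c (-a) z - 1‖ ≤
        C * log ‖z‖ ^ (-(min (a / (1 + a) / 2) (1 - a / (1 + a)))) := by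
  have hβ : 0 < a / (1 + a) := by positivity
  have hβ1 : a / (1 + a) < 1 := by rw [div_lt_one (by positivity)]; linarith
  obtain ⟨C₀, T, hC₀, hG⟩ := exists_abs_wright_div_sub_one_le ha hc
  have hone (t : ℝ) (ht : 0 < t) : 1 ≤ wright a (c * t ^ a) :=
    one_le_wright ha (mul_nonneg hc.le (rpow_nonneg ht.le a))
  obtain ⟨C, X, hC, hX, hmain⟩ := exists_norm_div_sub_one_le (G := fun t => wright a (c * t ^ a))
    (saddleK1_neg_pos ha hc) (saddleK2_neg_pos ha hc) hβ hβ1 hC₀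
    (fun t ht => zero_le_one.trans (hone t ht))
    (fun t s ht hts => wright_mono ha (mul_nonneg hc.le (rpow_nonneg ht.le a)) (by gcongr)) hG
  set ν := min (a / (1 + a) / 2) (1 - a / (1 + a)) with hν
  set κ := 2 / (1 - cos δ) with hκ
  refine ⟨C * κ * 8 + 2, X, hX, fun z hzX hz => ?_⟩
  set x := log ‖z‖ with hx
  have hx1 : 1 ≤ x := hX.trans hzX
  have hz0 : z ≠ 0 := by
    rintro rfl
    rw [hx, norm_zero, log_zero] at hx1
    linarith
  have hre : (Complex.log z).re = x := Complex.log_re z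
  have hlog0 : Complex.log z ≠ 0 := fun h => by rw [h, Complex.zero_re] at hre; linarith
  have hcut : z ∈ cutPlane := Or.inl (Complex.mem_slitPlane_iff_arg.2 ⟨fun h => by
    rw [h, abs_of_pos pi_pos] at hz; linarith, hz0⟩)
  set Z := (saddleK1 c (-a) : ℂ) *
    Complex.exp (saddleExponent (saddleK2 c (-a)) (a / (1 + a)) (Complex.log z)) with hZ
  have hZ0 : Z ≠ 0 := mul_ne_zero (Complex.ofReal_ne_zero.2 (saddleK1_neg_pos ha hc).ne')
    (Complex.exp_ne_zero _)
  have hpt := hmain (Complex.log z) (by rw [hre]; exact hzX)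
    (by rw [Complex.log_im]; exact hz.trans (by linarith))
  rw [hre] at hpt
  have hintG : IntegrableOn (fun t : ℝ => ((wright a (c * t ^ a) : ℝ) : ℂ) / Z * wrightKernel z t)
      (Ioi 0) := by
    refine ((integrableOn_wrightIntegrand ha hc hcut).div_const Z).congr
      (ae_of_all _ fun t => ?_)
    simp only [wrightKernel, one_mul, Complex.ofReal_mul]
    ring
  -- Subtracting the kernel's mass puts `W / Z - 1` under the integral; the missing part of the mass
  -- is `(1 + z)⁻¹`.
  have e1 : wrightIntegral c a z / saddleMain c (-a) z - 1 =
      (∫ t in Ioi (0 : ℝ), (((wright a (c * t ^ a) : ℝ) : ℂ) / Z - 1) * wrightKernel z t) -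
        (1 + z)⁻¹ := by
    have h1 : wrightIntegral c a z / saddleMain c (-a) z =
        ∫ t in Ioi (0 : ℝ), ((wright a (c * t ^ a) : ℝ) : ℂ) / Z * wrightKernel z t := by
      rw [saddleMain_neg_eq ha hlog0, wrightIntegral, neg_div_neg_eq, ← integral_div]
      refine integral_congr_ae (ae_of_all _ fun t => ?_)
      simp only [wrightKernel, one_mul, Complex.ofReal_mul]
      ring
    simp_rw [sub_mul, one_mul]
    rw [h1, integral_sub hintG (integrableOn_wrightKernel hcut), integral_wrightKernel hcut]
    ring
  have hbd : ‖∫ t in Ioi (0 : ℝ), (((wright a (c * t ^ a) : ℝ) : ℂ) / Z - 1) * wrightKernel z t‖ ≤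
      C * x ^ (-ν) * κ * 8 := by
    have hκ0 : 0 ≤ κ := div_nonneg two_pos.le (by linarith [cos_le_one δ])
    have hgi : Integrable fun t : ℝ => C * x ^ (-ν) * κ * exp (-(|t - x| / 4)) :=
      (integrable_exp_neg_abs_div_four.comp_sub_right x).const_mul _
    have h1 := norm_integral_le_of_norm_le (hgi.restrict (s := Ioi 0))
      ((ae_restrict_mem measurableSet_Ioi).mono fun t ht => ?_ :
        ∀ᵐ t ∂(volume.restrict (Ioi (0 : ℝ))),
          ‖(((wright a (c * t ^ a) : ℝ) : ℂ) / Z - 1) * wrightKernel z t‖ ≤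
            C * x ^ (-ν) * κ * exp (-(|t - x| / 4)))
    · refine h1.trans ((setIntegral_le_integral hgi (ae_of_all _ fun t => ?_)).trans (le_of_eq ?_))
      · simp only [Pi.zero_apply]; positivity
      · rw [integral_const_mul,
          integral_sub_right_eq_self (fun t : ℝ => exp (-(|t| / 4))) x,
          integral_exp_neg_abs_div_four]
    · rw [norm_mul]
      refine (mul_le_mul (hpt t ht) (norm_wrightKernel_le hδ0 hδ hz0 hz t) (norm_nonneg _)
        (by positivity)).trans (le_of_eq ?_)
      have : exp (-(|t - x| / 4)) = exp (3 / 4 * |t - x|) * exp (-|t - x|) := by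
        rw [← exp_add]; ring_nf
      rw [this]
      ring
  have hinv : ‖(1 + z)⁻¹‖ ≤ 2 * x ^ (-ν) := by
    have hzx : x + 1 ≤ ‖z‖ := by
      have := add_one_le_exp x
      rwa [hx, exp_log (norm_pos_iff.2 hz0)] at this
    have h1 : x ≤ ‖1 + z‖ := by
      have := norm_sub_le (1 + z) 1
      rw [add_sub_cancel_left, norm_one] at this
      linarith
    rw [norm_inv]
    have h2 : x⁻¹ ≤ x ^ (-ν) := by
      rw [← rpow_neg_one]
      exact rpow_le_rpow_of_exponent_le hx1 (by
        have : ν ≤ 1 - a / (1 + a) := min_le_right _ _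
        linarith)
    have h3 : ‖1 + z‖⁻¹ ≤ x⁻¹ := inv_anti₀ (by linarith) h1
    have h4 : 0 < x ^ (-ν) := by positivity
    linarith
  rw [e1]
  refine (norm_sub_le _ _).trans ((add_le_add hbd hinv).trans (le_of_eq ?_))
  ring

/-- The case distinction at `θ = -2` reflects that `β / 2 ≤ 1 - β` exactly when `a ≤ 2`. The
exponent obtained here is the minimum itself, without the loss of `ε`. -/
theorem saddleMu_neg_le {a ε : ℝ} (ha : 0 < a) (hε : 0 < ε) :
    saddleMu (-a) ε ≤ min (a / (1 + a) / 2) (1 - a / (1 + a)) := by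
  have h1 : 0 < 1 + a := by positivity
  have e1 : 1 - a / (1 + a) = 1 / (1 + a) := by field_simp; ring
  have e2 : -a / (2 * (-a - 1)) = a / (1 + a) / 2 := by
    rw [← neg_add', add_comm a 1, mul_neg, neg_div_neg_eq, div_div, mul_comm]
  rw [saddleMu, e1, e2, sub_neg_eq_add, div_div]
  split_ifs with h
  · have : a / ((1 + a) * 2) ≤ 1 / (1 + a) := by
      rw [div_le_div_iff₀ (by positivity) h1]; nlinarith
    exact le_min (by linarith) (by linarith)
  · refine le_min ?_ le_rfl
    rw [div_le_div_iff₀ h1 (by positivity)]; nlinarith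

theorem mainTheorem6 (c θ : ℝ) (hc : 0 < c) (hθ : θ < 0) :
    0 < saddleK1 c θ ∧ 0 < saddleK2 c θ ∧
    (∃ E : ℂ → ℂ, IsGeneralizedExp c θ E) ∧
    ∀ E : ℂ → ℂ, IsGeneralizedExp c θ E →
      ∀ δ : ℝ, 0 < δ → ∀ ε : ℝ, 0 < ε →
        ∃ ρ : ℂ → ℂ,
          ρ =O[inftyInSector δ] (fun z => Complex.log z ^ ((-saddleMu θ ε : ℝ) : ℂ)) ∧
          ∀ᶠ z in inftyInSector δ, E z = saddleMain c θ z * (1 + ρ z) := by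
  obtain ⟨a, rfl⟩ : ∃ a, θ = -a := ⟨-θ, (neg_neg θ).symm⟩
  have ha : 0 < a := by linarith
  refine ⟨saddleK1_neg_pos ha hc, saddleK2_neg_pos ha hc,
    ⟨_, isGeneralizedExp_wrightIntegral ha hc⟩, fun E hE δ hδ ε hε => ?_⟩
  refine ⟨fun z => E z / saddleMain c (-a) z - 1, ?_⟩
  -- For `δ > π` the sector is empty and the filter is `⊥`.
  rcases lt_or_ge Real.pi δ with hδπ | hδπ
  · have hbot : inftyInSector δ = ⊥ := by
      have : {z : ℂ | |z.arg| ≤ Real.pi - δ} = ∅ :=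
        Set.eq_empty_iff_forall_notMem.2 fun z hz => by
          have h1 : |z.arg| ≤ Real.pi - δ := hz
          linarith [abs_nonneg z.arg]
      rw [inftyInSector, this, principal_empty, inf_bot_eq]
    rw [hbot]
    exact ⟨Asymptotics.isBigO_bot _ _, eventually_bot⟩
  obtain ⟨C, X, hX, hmain⟩ := exists_norm_wrightIntegral_div_sub_one_le ha hc hδ hδπ
  set ν := min (a / (1 + a) / 2) (1 - a / (1 + a)) with hν
  -- Requiring `log ‖z‖ ≥ π` gives `‖log z‖ ≤ 2 log ‖z‖`, so powers of the two are comparable.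
  have hlarge : ∀ᶠ z in inftyInSector δ,
      max X Real.pi ≤ Real.log ‖z‖ ∧ |z.arg| ≤ Real.pi - δ := by
    refine Eventually.and ?_ (mem_inf_of_right (mem_principal_self _))
    exact Filter.Eventually.filter_mono inf_le_left
      ((Real.tendsto_log_atTop.comp tendsto_norm_cobounded_atTop).eventually_ge_atTop _)
  have hcut {z : ℂ} (h : max X Real.pi ≤ Real.log ‖z‖ ∧ |z.arg| ≤ Real.pi - δ) :
      Complex.log z ≠ 0 ∧ z ∈ cutPlane := by
    have h1 : 1 ≤ Real.log ‖z‖ := hX.trans ((le_max_left _ _).trans h.1)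
    constructor
    · intro h0
      have := Complex.log_re z
      rw [h0, Complex.zero_re] at this
      linarith
    · refine Or.inl (Complex.mem_slitPlane_iff_arg.2 ⟨fun h2 => ?_, ?_⟩)
      · have := h.2
        rw [h2, abs_of_pos Real.pi_pos] at this
        linarith
      · rintro rfl
        rw [norm_zero, Real.log_zero] at h1
        linarith
  constructor
  · refine Asymptotics.IsBigO.of_bound (max C 0 * 2 ^ ν) (hlarge.mono fun z hz => ?_)
    obtain ⟨hlog0, hzc⟩ := hcut hz
    set x := Real.log ‖z‖ with hx
    have hx1 : 1 ≤ x := hX.trans ((le_max_left _ _).trans hz.1)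
    have hxL : x ≤ ‖Complex.log z‖ := by
      rw [hx, ← Complex.log_re]
      exact (le_abs_self _).trans (Complex.abs_re_le_norm _)
    have hLx : ‖Complex.log z‖ ≤ 2 * x := by
      refine (Complex.norm_le_abs_re_add_abs_im _).trans ?_
      rw [Complex.log_re, Complex.log_im, ← hx, abs_of_pos (by linarith)]
      linarith [hz.2, (le_max_right X Real.pi).trans hz.1]
    have hν0 : 0 ≤ ν := by
      refine le_min (by positivity) (sub_nonneg.2 ?_)
      rw [div_le_one (by positivity)]
      linarith
    rw [hE.eqOn (isGeneralizedExp_wrightIntegral ha hc) hzc, Complex.norm_cpow_real]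
    refine (hmain z ((le_max_left _ _).trans hz.1) hz.2).trans ?_
    have h1 : x ^ (-ν) ≤ 2 ^ ν * ‖Complex.log z‖ ^ (-ν) := by
      have h2 : (2 * x) ^ (-ν) ≤ ‖Complex.log z‖ ^ (-ν) :=
        Real.rpow_le_rpow_of_nonpos (by linarith) hLx (by linarith)
      rw [Real.mul_rpow two_pos.le (by linarith), Real.rpow_neg two_pos.le] at h2
      have h3 : (0 : ℝ) < 2 ^ ν := by positivity
      calc x ^ (-ν) = 2 ^ ν * ((2 ^ ν)⁻¹ * x ^ (-ν)) := by field_simp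
        _ ≤ _ := mul_le_mul_of_nonneg_left h2 h3.le
    have h4 : ‖Complex.log z‖ ^ (-ν) ≤ ‖Complex.log z‖ ^ (-saddleMu (-a) ε) :=
      Real.rpow_le_rpow_of_exponent_le (hx1.trans hxL) (neg_le_neg (saddleMu_neg_le ha hε))
    calc C * x ^ (-ν) ≤ max C 0 * x ^ (-ν) := by gcongr; exact le_max_left _ _
      _ ≤ max C 0 * (2 ^ ν * ‖Complex.log z‖ ^ (-saddleMu (-a) ε)) := by
          refine mul_le_mul_of_nonneg_left (h1.trans ?_) (le_max_right _ _)
          gcongr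
      _ = _ := by ring
  · refine hlarge.mono fun z hz => ?_
    have hm : saddleMain c (-a) z ≠ 0 := by
      rw [saddleMain_neg_eq ha (hcut hz).1]
      exact neg_ne_zero.2 (mul_ne_zero
        (Complex.ofReal_ne_zero.2 (saddleK1_neg_pos ha hc).ne') (Complex.exp_ne_zero _))
    rw [add_sub_cancel, mul_div_cancel₀ _ hm]
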